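/- Let $X=(X_1,\dots,X_d)$ be an infinitely divisible random vector in $\mathbb{R}^d$ without Gaussian component, i.e. there are $\gamma\in\mathbb{R}^d$ and a Lévy measure $\nu$ (a positive Borel measure on $\mathbb{R}^d$ with $\nu(\{0\})=0$ and $\int(1\wedge\|u\|_2^2)\,\nu(du)<\infty$) with $$\mathbb{E}e^{i\langle s,X\rangle}=\exp\Big\{i\langle s,\gamma\rangle+\int_{\mathbb{R}^d}\big(e^{i\langle s,u\rangle}-1-i\langle s,u\rangle\mathbf{1}_{\|u\|_2\le1}\big)\,\nu(du)\Big\},\qquad s\in\mathbb{R}^d .$$ Assume that $X$ has i.i.d. components, with $$\nu(dx_1,\dots,dx_d)=\sum_{k=1}^d\delta_0(dx_1)\cdots\delta_0(dx_{k-1})\,\tilde\nu(dx_k)\,\delta_0(dx_{k+1})\cdots\delta_0(dx_d),$$ where $\tilde\nu$ is the common one-dimensional Lévy measure of the components, and that $\mathbb{E}e^{s\|X\|_2}<\infty$ for some $s>0$. Let $e_1,\dots,e_d$ be the canonical basis of $\mathbb{R}^d$. Let $f:\mathbb{R}^d\to\mathbb{R}$ satisfy $\mathbb{E}f(X)=0$,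 and let $b\neq0$ be a real number such that $|f(x+ue_k)-f(x)|\le b|u|$ for all $k$, all $u\in\mathbb{R}$ and all $x\in\mathbb{R}^d$. Assume that for every $u\in\mathbb{R}$ there is a function $C_u:\mathbb{R}^d\to\mathbb{R}$ such that, almost surely, $$\sum_{k=1}^d|f(X+ue_k)-f(X)|^2\le u^2\,C_u(X).$$ Let $t\ge0$ and let $\lambda(u,t)>0$, $u\in\mathbb{R}$, be such that $\phi(u,t):=\mathbb{E}[e^{\lambda(u,t)C_u(X)}]<\infty$ for every $u\in\mathbb{R}$. Put $$h(t)=\int_{\mathbb{R}}\frac{t}{\lambda(u,t)}\,|u|\,\frac{e^{tb|u|}-1}{b}\,\tilde\nu(du),\qquad g(t)=\int_{\mathbb{R}}\frac{\ln\phi(u,t)}{\lambda(u,t)}\,|u|\,\frac{e^{tb|u|}-1}{b}\,\tilde\nu(du),$$ and assume that these two integrals converge absolutely and that $e^{tf(X)}$ and $f(X)e^{tf(X)}$ are integrable. Then $$(1-h(t))\,\mathbb{E}\big[f(X)e^{tf(X)}\big]\le g(t)\,\mathbb{E}\big[e^{tf(X)}\big].$$ -/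

import Mathlib

open MeasureTheory ProbabilityTheory

/-- A Lévy measure: a Borel measure without atom at the origin such that
`∫ (1 ∧ ‖u‖²) ν(du) < ∞`. -/
structure IsLevyMeasure {E : Type*} [NormedAddCommGroup E] [MeasurableSpace E]
    (ν : Measure E) : Prop where
  zero_atom : ν {0} = 0
  lintegral_lt_top : ∫⁻ u, ENNReal.ofReal (min 1 (‖u‖ ^ 2)) ∂ν < ⊤

/-- The Lévy–Khintchine exponent of `ID(γ, 0, ν)` (no Gaussian component), with the truncation
function `𝟙 {‖u‖ ≤ 1}`. -/
noncomputable def levyExponent {E : Type*} [NormedAddCommGroup E] [InnerProductSpace ℝ E]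
    [MeasurableSpace E] (γ : E) (ν : Measure E) (t : E) : ℂ :=
  Complex.I * (inner ℝ t γ : ℝ) +
    ∫ u, (Complex.exp (Complex.I * (inner ℝ t u : ℝ)) - 1 -
      Set.indicator {u : E | ‖u‖ ≤ 1} (fun u => Complex.I * (inner ℝ t u : ℝ)) u) ∂ν

/-- The random vector `X`, defined on `(Ω, P)`, is infinitely divisible without Gaussian
component: `X ∼ ID(γ, 0, ν)`. -/
structure HasIDLaw {Ω E : Type*} [MeasurableSpace Ω] [NormedAddCommGroup E]
    [InnerProductSpace ℝ E] [MeasurableSpace E]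
    (X : Ω → E) (γ : E) (ν : Measure E) (P : Measure Ω) : Prop where
  aemeasurable : AEMeasurable X P
  isLevyMeasure : IsLevyMeasure ν
  charFun_eq : ∀ t : E, charFun (P.map X) t = Complex.exp (levyExponent γ ν t)

/-- The measure on `ℝᵈ` that is supported on the axes, with the one-dimensional measure `ν' k` on
the `k`-th axis:
`∑ₖ δ₀(dx₁) ⋯ δ₀(dxₖ₋₁) ν'ₖ(dxₖ) δ₀(dxₖ₊₁) ⋯ δ₀(dx_d)`. -/
noncomputable def axisMeasure {d : ℕ} (ν' : Fin d → Measure ℝ) :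
    Measure (EuclideanSpace ℝ (Fin d)) :=
  ∑ k, (ν' k).map (fun u : ℝ => EuclideanSpace.single k u)

/-- The components of `X` are independent and identically distributed. -/
def HasIIDComponents {Ω : Type*} [MeasurableSpace Ω] {d : ℕ}
    (X : Ω → EuclideanSpace ℝ (Fin d)) (P : Measure Ω) : Prop :=
  iIndepFun (fun (k : Fin d) (ω : Ω) => X ω k) P ∧
    ∀ j k : Fin d, IdentDistrib (fun ω => X ω j) (fun ω => X ω k) P P

/-- `φ(u, t) = 𝔼[exp(lam(u, t) C_u(X))]`. -/
noncomputable def phiMoment {Ω E : Type*} [MeasurableSpace Ω] (P : Measure Ω) (X : Ω → E)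
    (C : ℝ → E → ℝ) (lam : ℝ → ℝ → ℝ) (u t : ℝ) : ℝ :=
  ∫ ω, Real.exp (lam u t * C u (X ω)) ∂P

/-- The integrand `(t / lam(u, t)) |u| (e^{t b |u|} - 1) / b` of `h(t)`. -/
noncomputable def hIntegrand (lam : ℝ → ℝ → ℝ) (b t u : ℝ) : ℝ :=
  t / lam u t * |u| * ((Real.exp (t * b * |u|) - 1) / b)

/-- The integrand `(ln φ(u, t) / lam(u, t)) |u| (e^{t b |u|} - 1) / b` of `g(t)`. -/
noncomputable def gIntegrand {Ω E : Type*} [MeasurableSpace Ω] (P : Measure Ω) (X : Ω → E)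
    (C : ℝ → E → ℝ) (lam : ℝ → ℝ → ℝ) (b t u : ℝ) : ℝ :=
  Real.log (phiMoment P X C lam u t) / lam u t * |u| * ((Real.exp (t * b * |u|) - 1) / b)

/-- `h(t)`. -/
noncomputable def hFun (ν' : Measure ℝ) (lam : ℝ → ℝ → ℝ) (b t : ℝ) : ℝ :=
  ∫ u, hIntegrand lam b t u ∂ν'

/-- `g(t)`. -/
noncomputable def gFun {Ω E : Type*} [MeasurableSpace Ω] (P : Measure Ω) (X : Ω → E)
    (ν' : Measure ℝ) (C : ℝ → E → ℝ) (lam : ℝ → ℝ → ℝ) (b t : ℝ) : ℝ :=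
  ∫ u, gIntegrand P X C lam b t u ∂ν'

/-! The proof estimates Cov(f(X), e^{tf(X)}), which equals E[f(X)e^{tf(X)}] since f(X) is centred.
It rests on a covariance representation for infinitely divisible laws: Cov(f(X), g(X)) is a limit of
integrals ∫ E[(f(Y+u)-f(Y))(g(Z+u)-g(Z))] ν(du) over jumps |u| > 1/(n+1), where Y and Z are coupled
and both have the law of X (`exists_covariance_coupling`).

For the coupling, the large jumps of X are split off as a compound Poisson summand. Two copies share
the remainder, and their large jumps are interpolated, with z in [0,1], between independent (z = 0)
and common (z = 1). The exponent is affine in z, so integrating the z-derivative of its exponential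
produces the increments (`interpolation_identity`). The endpoint z = 1 is (X, X), and the endpoint z
= 0 becomes a pair of independent copies as n → ∞.

Take g = e^{tf}. The jumps lie on the axes, so convexity of exp and 2AB ≤ A² + B² reduce the
integrand to e^{tf(Z)} times the squared increments at Y and at Z. The entropy inequality
(`integral_exp_mul_le_entropy`) separates these factors using only the marginals, and Jensen bounds
the entropy of e^{tf} by t Cov(f, e^{tf}). Integration over u gives Cov ≤ h(t) Cov + g(t) E e^{tf}
for bounded f (`expCov_le_of_bounded`), and truncation extends it to the given f. -/

/-! ### Compound Poisson laws and their interpolation. -/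

section CompoundPoisson

variable {F : Type*} [NormedAddCommGroup F] [NormedSpace ℝ F] [MeasurableSpace F] [BorelSpace F]
  [SecondCountableTopology F]

/-- The `n`-fold convolution power of a measure. -/
noncomputable def convPow (ρ : Measure F) : ℕ → Measure F
  | 0 => Measure.dirac 0
  | n + 1 => (convPow ρ n).conv ρ

/-- The compound Poisson law with jump measure `ρ`. -/
noncomputable def compoundPoisson (ρ : Measure F) : Measure F :=
  Measure.sum fun n => ENNReal.ofReal (Real.exp (-ρ.real Set.univ) / n.factorial) • convPow ρ n

/-- The exponent of the compound Poisson law with jump measure `ρ`. -/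
noncomputable def jumpExponent (ρ : Measure F) (L : StrongDual ℝ F) : ℂ :=
  charFunDual ρ L - (ρ.real Set.univ : ℂ)

instance (ρ : Measure F) [IsFiniteMeasure ρ] (n : ℕ) : IsFiniteMeasure (convPow ρ n) := by
  induction n with
  | zero => rw [convPow]; infer_instance
  | succ n ih => rw [convPow]; infer_instance

omit [NormedSpace ℝ F] in
lemma conv_apply_univ (μ ν : Measure F) [SFinite μ] [SFinite ν] :
    (μ.conv ν) Set.univ = μ Set.univ * ν Set.univ := by
  rw [Measure.conv, Measure.map_apply (by fun_prop) MeasurableSet.univ, Set.preimage_univ,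
    ← Set.univ_prod_univ, Measure.prod_prod]

omit [NormedSpace ℝ F] in
lemma convPow_apply_univ (ρ : Measure F) [IsFiniteMeasure ρ] (n : ℕ) :
    convPow ρ n Set.univ = ρ Set.univ ^ n := by
  induction n with
  | zero => simp [convPow]
  | succ n ih => rw [convPow, conv_apply_univ, ih, pow_succ]

lemma charFunDual_convPow (ρ : Measure F) [IsFiniteMeasure ρ] (n : ℕ) (L : StrongDual ℝ F) :
    charFunDual (convPow ρ n) L = charFunDual ρ L ^ n := by
  induction n with
  | zero => simp [convPow, charFunDual_dirac]
  | succ n ih => rw [convPow, charFunDual_conv, ih, pow_succ]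

instance (ρ : Measure F) [IsFiniteMeasure ρ] : IsProbabilityMeasure (compoundPoisson ρ) := by
  constructor
  rw [compoundPoisson, Measure.sum_apply _ MeasurableSet.univ]
  have h : ∀ n : ℕ, (ENNReal.ofReal (Real.exp (-ρ.real Set.univ) / n.factorial) • convPow ρ n)
      Set.univ = ENNReal.ofReal
        (Real.exp (-ρ.real Set.univ) * (ρ.real Set.univ ^ n / n.factorial)) := by
    intro n
    rw [Measure.smul_apply, convPow_apply_univ, smul_eq_mul,
      ← ENNReal.ofReal_toReal (measure_ne_top ρ Set.univ),
      ← ENNReal.ofReal_pow ENNReal.toReal_nonneg, ← ENNReal.ofReal_mul (by positivity)]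
    simp only [Measure.real]
    congr 1
    ring
  simp_rw [h]
  have hs := (NormedSpace.expSeries_div_hasSum_exp (ρ.real Set.univ)).mul_left
    (Real.exp (-ρ.real Set.univ))
  rw [← congrFun Real.exp_eq_exp_ℝ, ← Real.exp_add, neg_add_cancel, Real.exp_zero] at hs
  rw [← ENNReal.ofReal_tsum_of_nonneg (fun n => by positivity) hs.summable, hs.tsum_eq,
    ENNReal.ofReal_one]

lemma charFunDual_compoundPoisson (ρ : Measure F) [IsFiniteMeasure ρ] (L : StrongDual ℝ F) :
    charFunDual (compoundPoisson ρ) L = Complex.exp (jumpExponent ρ L) := by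
  have hint : Integrable (fun v => Complex.exp (L v * Complex.I)) (compoundPoisson ρ) :=
    (integrable_const (1 : ℝ)).mono (by fun_prop) (by simp)
  have h1 := hasSum_integral_measure hint
  have h2 : ∀ n : ℕ, ∫ v, Complex.exp (L v * Complex.I)
      ∂(ENNReal.ofReal (Real.exp (-ρ.real Set.univ) / n.factorial) • convPow ρ n) =
      Complex.exp (-(ρ.real Set.univ : ℂ)) * (charFunDual ρ L ^ n / n.factorial) := by
    intro n
    rw [integral_smul_measure, ← charFunDual_apply, charFunDual_convPow,
      ENNReal.toReal_ofReal (by positivity), Complex.real_smul]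
    push_cast
    ring
  simp_rw [h2] at h1
  have h3 := (NormedSpace.expSeries_div_hasSum_exp (charFunDual ρ L)).mul_left
    (Complex.exp (-(ρ.real Set.univ : ℂ)))
  rw [charFunDual_apply]
  refine h1.unique ?_
  rw [← congrFun Complex.exp_eq_exp_ℂ, ← Complex.exp_add] at h3
  rwa [jumpExponent, sub_eq_neg_add]

omit [NormedSpace ℝ F] in
lemma measurable_convPow {α : Type*} [MeasurableSpace α] (κ : Kernel α F) [IsFiniteKernel κ]
    (n : ℕ) : Measurable fun a => convPow (κ a) n := by
  induction n with
  | zero => simp only [convPow]; exact measurable_const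
  | succ n ih =>
    simp only [convPow]
    let η : Kernel α F := ⟨fun a => convPow (κ a) n, ih⟩
    have hη : IsFiniteKernel η := by
      refine ⟨⟨(κ.bound) ^ n, ENNReal.pow_lt_top (Kernel.bound_lt_top κ), fun a => ?_⟩⟩
      change convPow (κ a) n Set.univ ≤ _
      rw [convPow_apply_univ]
      gcongr
      exact Kernel.measure_le_bound κ a _
    have h := ((η.prod κ).map (fun p : F × F => p.1 + p.2)).measurable
    convert h using 2 with a
    rw [Kernel.map_apply _ (by fun_prop), Kernel.prod_apply]
    rfl

-- Measurability in the parameter makes these laws a kernel, so that they can be mixed over the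
-- interpolation parameter.
omit [NormedSpace ℝ F] in
lemma measurable_compoundPoisson {α : Type*} [MeasurableSpace α] (κ : Kernel α F)
    [IsFiniteKernel κ] : Measurable fun a => compoundPoisson (κ a) := by
  refine Measure.measurable_of_measurable_coe _ fun s hs => ?_
  simp only [compoundPoisson, Measure.sum_apply _ hs, Measure.smul_apply, smul_eq_mul]
  refine Measurable.tsum fun n => ?_
  have h1 : Measurable fun a => (κ a).real Set.univ :=
    (κ.measurable_coe MeasurableSet.univ).ennreal_toReal
  have h2 : Measurable fun a => convPow (κ a) n s :=
    (Measure.measurable_coe hs).comp (measurable_convPow κ n)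
  fun_prop

-- Because the exponent is linear in the jump measure, interpolating jump measures moves the
-- exponent along a segment.
omit [SecondCountableTopology F] in
lemma jumpExponent_smul_add_smul (A B : Measure F) [IsFiniteMeasure A] [IsFiniteMeasure B]
    {x y : ℝ} (hx : 0 ≤ x) (hy : 0 ≤ y) (L : StrongDual ℝ F) :
    jumpExponent (ENNReal.ofReal x • A + ENNReal.ofReal y • B) L =
      x * jumpExponent A L + y * jumpExponent B L := by
  have hi : ∀ (ρ : Measure F) [IsFiniteMeasure ρ],
      Integrable (fun v => Complex.exp (L v * Complex.I)) ρ := fun ρ _ =>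
    (integrable_const (1 : ℝ)).mono (by fun_prop) (by simp)
  have hA : IsFiniteMeasure (ENNReal.ofReal x • A) := A.smul_finite ENNReal.ofReal_ne_top
  have hB : IsFiniteMeasure (ENNReal.ofReal y • B) := B.smul_finite ENNReal.ofReal_ne_top
  rw [jumpExponent, charFunDual_apply, integral_add_measure (hi _) (hi _), integral_smul_measure,
    integral_smul_measure, measureReal_add_apply, measureReal_ennreal_smul_apply,
    measureReal_ennreal_smul_apply, ENNReal.toReal_ofReal hx, ENNReal.toReal_ofReal hy,
    jumpExponent, jumpExponent, charFunDual_apply, charFunDual_apply, Complex.real_smul,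
    Complex.real_smul]
  push_cast
  ring

/-- The uniform mixture of the compound Poisson laws whose jump measures interpolate linearly
between `A` and `B`. -/
lemma exists_mixture_compoundPoisson (A B : Measure F) [IsFiniteMeasure A] [IsFiniteMeasure B] :
    ∃ M : Measure F, IsProbabilityMeasure M ∧ ∀ L : StrongDual ℝ F, charFunDual M L =
      ∫ z in (0 : ℝ)..1,
        Complex.exp (z * jumpExponent A L + ((1 - z : ℝ) : ℂ) * jumpExponent B L) := by
  -- Clamping gives a finite kernel on all of ℝ; only z in (0, 1], where `c z = z`, is charged by
  -- `V`.
  let c : ℝ → ℝ := fun z => max 0 (min 1 z)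
  have hc : Measurable c := by fun_prop
  have hc0 : ∀ z, 0 ≤ c z := fun z => le_max_left _ _
  have hc1 : ∀ z, c z ≤ 1 := fun z => max_le zero_le_one (min_le_left _ _)
  have hm : Measurable fun z => ENNReal.ofReal (c z) • A + ENNReal.ofReal (1 - c z) • B := by
    refine Measure.measurable_of_measurable_coe _ fun s hs => ?_
    simp only [Measure.add_apply, Measure.smul_apply, smul_eq_mul]
    fun_prop
  let κ : Kernel ℝ F := ⟨_, hm⟩
  have hκ : ∀ z, κ z = ENNReal.ofReal (c z) • A + ENNReal.ofReal (1 - c z) • B := fun z => rfl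
  have hfin : IsFiniteKernel κ := by
    refine ⟨⟨A Set.univ + B Set.univ, by finiteness, fun z => ?_⟩⟩
    rw [hκ, Measure.add_apply, Measure.smul_apply, Measure.smul_apply, smul_eq_mul, smul_eq_mul]
    gcongr
    · exact mul_le_of_le_one_left' (by simpa using hc1 z)
    · exact mul_le_of_le_one_left' (by simpa using hc0 z)
  let K : Kernel ℝ F := ⟨_, measurable_compoundPoisson κ⟩
  have hK : ∀ z, K z = compoundPoisson (κ z) := fun z => rfl
  have hKp : IsMarkovKernel K := ⟨fun z => by rw [hK]; infer_instance⟩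
  let V : Measure ℝ := volume.restrict (Set.Ioc 0 1)
  have hV : IsProbabilityMeasure V := ⟨by simp [V]⟩
  refine ⟨V.bind K, inferInstance, fun L => ?_⟩
  have hbind : V.bind K = (K ∘ₖ Kernel.const Unit V) () := by
    rw [Kernel.comp_apply, Kernel.const_apply]
  rw [charFunDual_apply, hbind, Kernel.integral_comp
    ((integrable_const (1 : ℝ)).mono (by fun_prop) (by simp)), Kernel.const_apply,
    intervalIntegral.integral_of_le zero_le_one]
  refine setIntegral_congr_fun measurableSet_Ioc fun z hz => ?_
  have hz' : c z = z := by
    simp only [c]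
    rw [min_eq_right hz.2, max_eq_right hz.1.le]
  change ∫ v, Complex.exp (L v * Complex.I) ∂(K z) = _
  rw [← charFunDual_apply, hK, charFunDual_compoundPoisson, hκ,
    jumpExponent_smul_add_smul _ _ (hc0 z) (sub_nonneg.2 (hc1 z)), hz']

/-- The fundamental theorem of calculus along the segment from `b` to `a`. On the Fourier side this
is the covariance representation. -/
lemma integral_exp_segment_mul (a b : ℂ) :
    (∫ z in (0 : ℝ)..1, Complex.exp (z * a + ((1 - z : ℝ) : ℂ) * b)) * (a - b) =
      Complex.exp a - Complex.exp b := by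
  have hd : ∀ z : ℝ, HasDerivAt (fun z : ℝ => Complex.exp (z * a + ((1 - z : ℝ) : ℂ) * b))
      (Complex.exp (z * a + ((1 - z : ℝ) : ℂ) * b) * (a - b)) z := by
    intro z
    have h1 : HasDerivAt (fun w : ℂ => w * a + (1 - w) * b) (a - b) (z : ℂ) := by
      have := ((hasDerivAt_id (z : ℂ)).mul_const a).add
        (((hasDerivAt_id (z : ℂ)).const_sub 1).mul_const b)
      refine (this.congr_deriv (by ring)).congr_of_eventuallyEq (Filter.Eventually.of_forall ?_)
      intro w
      simp
    have := h1.cexp.comp_ofReal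
    simpa using this
  rw [← intervalIntegral.integral_mul_const,
    intervalIntegral.integral_eq_sub_of_hasDerivAt (fun z _ => hd z)
      (Continuous.intervalIntegrable (by fun_prop) _ _)]
  simp

variable [CompleteSpace F]

/-- Interpolation between two compound Poisson laws, perturbed by an independent noise `Q`. -/
lemma interpolation_identity (A B M Q : Measure F) [IsFiniteMeasure A] [IsFiniteMeasure B]
    [IsProbabilityMeasure M] [IsProbabilityMeasure Q]
    (hM : ∀ L : StrongDual ℝ F, charFunDual M L = ∫ z in (0 : ℝ)..1,
        Complex.exp (z * jumpExponent A L + ((1 - z : ℝ) : ℂ) * jumpExponent B L)) :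
    (compoundPoisson A).conv Q + ((M.conv Q).conv B + A Set.univ • M.conv Q) =
      (compoundPoisson B).conv Q + ((M.conv Q).conv A + B Set.univ • M.conv Q) := by
  have hi : ∀ (ρ : Measure F) [IsFiniteMeasure ρ] (L : StrongDual ℝ F),
      Integrable (fun v => Complex.exp (L v * Complex.I)) ρ := fun ρ _ L =>
    (integrable_const (1 : ℝ)).mono (by fun_prop) (by simp)
  have f1 : IsFiniteMeasure (A Set.univ • M.conv Q) := Measure.smul_finite _ (measure_ne_top _ _)
  have f2 : IsFiniteMeasure (B Set.univ • M.conv Q) := Measure.smul_finite _ (measure_ne_top _ _)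
  have hadd : ∀ (ρ σ : Measure F) [IsFiniteMeasure ρ] [IsFiniteMeasure σ] (L : StrongDual ℝ F),
      charFunDual (ρ + σ) L = charFunDual ρ L + charFunDual σ L := by
    intro ρ σ _ _ L
    simp only [charFunDual_apply]
    exact integral_add_measure (hi _ _) (hi _ _)
  have hsmul : ∀ (x : ENNReal) (ρ : Measure F) (L : StrongDual ℝ F),
      charFunDual (x • ρ) L = x.toReal * charFunDual ρ L := by
    intro x ρ L
    simp only [charFunDual_apply]
    rw [integral_smul_measure, Complex.real_smul]
  -- On the Fourier side this is e^a - e^b = (a - b) ∫ e^{za+(1-z)b} dz for the two exponents, times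
  -- the transform of `Q`. The negative terms have changed sides so that both members are positive
  -- measures.
  refine Measure.ext_of_charFunDual (funext fun L => ?_)
  simp only [hadd, hsmul, charFunDual_conv, charFunDual_compoundPoisson]
  have h := integral_exp_segment_mul (jumpExponent A L) (jumpExponent B L)
  rw [← hM L] at h
  have hA : charFunDual A L = jumpExponent A L + ((A Set.univ).toReal : ℂ) := by
    rw [jumpExponent, Measure.real]; ring
  have hB : charFunDual B L = jumpExponent B L + ((B Set.univ).toReal : ℂ) := by
    rw [jumpExponent, Measure.real]; ring
  rw [hA, hB]
  linear_combination (-charFunDual Q L) * h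

end CompoundPoisson

/-! ### Splitting off the large jumps of an infinitely divisible law. -/

section LevyTriplet

variable {E : Type*} [NormedAddCommGroup E] [InnerProductSpace ℝ E] [MeasurableSpace E]
  [BorelSpace E]

/-- The complement of the closed ball of radius `1 / (n + 1)`. -/
def largeJumps (E : Type*) [NormedAddCommGroup E] (n : ℕ) : Set E :=
  {u | 1 / ((n : ℝ) + 1) < ‖u‖}

/-- The compensated exponential in the Lévy–Khintchine formula. -/
noncomputable def levyIntegrand (s u : E) : ℂ :=
  Complex.exp (Complex.I * (inner ℝ s u : ℝ)) - 1 -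
    Set.indicator {u : E | ‖u‖ ≤ 1} (fun u => Complex.I * (inner ℝ s u : ℝ)) u

omit [InnerProductSpace ℝ E] in
lemma measurableSet_largeJumps (n : ℕ) : MeasurableSet (largeJumps E n) :=
  measurableSet_lt measurable_const measurable_norm

omit [InnerProductSpace ℝ E] [MeasurableSpace E] [BorelSpace E] in
lemma monotone_largeJumps : Monotone (largeJumps E) := by
  intro m n h u hu
  refine lt_of_le_of_lt (b := 1 / ((m : ℝ) + 1)) ?_ hu
  exact one_div_le_one_div_of_le (by positivity) (by exact_mod_cast Nat.succ_le_succ h)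

omit [InnerProductSpace ℝ E] [MeasurableSpace E] [BorelSpace E] in
lemma iUnion_largeJumps : ⋃ n, largeJumps E n = {0}ᶜ := by
  ext u
  simp only [Set.mem_iUnion, Set.mem_compl_iff, Set.mem_singleton_iff, largeJumps,
    Set.mem_ofPred_eq]
  constructor
  · rintro ⟨n, hn⟩ rfl
    rw [norm_zero] at hn
    exact absurd hn (not_lt.2 (by positivity))
  · intro hu
    exact exists_nat_one_div_lt (norm_pos_iff.2 hu)

omit [InnerProductSpace ℝ E] in
lemma IsLevyMeasure.integrable {ν : Measure E} (hν : IsLevyMeasure ν) :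
    Integrable (fun u : E => min 1 (‖u‖ ^ 2)) ν := by
  refine ⟨by fun_prop, ?_⟩
  rw [hasFiniteIntegral_iff_ofReal (Filter.Eventually.of_forall fun u => by positivity)]
  exact hν.lintegral_lt_top

omit [InnerProductSpace ℝ E] in
lemma IsLevyMeasure.isFiniteMeasure_restrict {ν : Measure E} (hν : IsLevyMeasure ν) (n : ℕ) :
    IsFiniteMeasure (ν.restrict (largeJumps E n)) := by
  refine ⟨?_⟩
  rw [Measure.restrict_apply_univ]
  have h : (0 : ℝ) < min 1 ((1 / ((n : ℝ) + 1)) ^ 2) := by positivity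
  refine lt_of_le_of_lt (measure_mono ?_) (hν.integrable.measure_ge_lt_top h)
  intro u hu
  have hu' : 1 / ((n : ℝ) + 1) < ‖u‖ := hu
  simp only [Set.mem_ofPred_eq]
  gcongr

-- With x = ⟨s,u⟩ and ‖u‖ ≤ 1, the bound is x² if |x| ≤ 1 and 2 + |x| ≤ 3x² otherwise, where x² ≤
-- ‖s‖²‖u‖². For ‖u‖ > 1 there is no compensation and the bound is 2.
omit [MeasurableSpace E] [BorelSpace E] in
lemma norm_levyIntegrand_le (s u : E) :
    ‖levyIntegrand s u‖ ≤ (2 + 3 * ‖s‖ ^ 2) * min 1 (‖u‖ ^ 2) := by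
  have hexp : ‖Complex.exp (Complex.I * (inner ℝ s u : ℝ))‖ = 1 :=
    Complex.norm_exp_I_mul_ofReal _
  by_cases hu : ‖u‖ ≤ 1
  · have hmin : min 1 (‖u‖ ^ 2) = ‖u‖ ^ 2 := min_eq_right (pow_le_one₀ (norm_nonneg _) hu)
    rw [levyIntegrand, Set.indicator_of_mem (show u ∈ {u : E | ‖u‖ ≤ 1} from hu), hmin]
    set x : ℝ := inner ℝ s u
    have hx : |x| ≤ ‖s‖ * ‖u‖ := abs_real_inner_le_norm s u
    have hx2 : x ^ 2 ≤ ‖s‖ ^ 2 * ‖u‖ ^ 2 := by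
      rw [← sq_abs, ← mul_pow]; gcongr
    have hn : ‖Complex.I * (x : ℂ)‖ = |x| := by simp
    have hs : 0 ≤ ‖u‖ ^ 2 := by positivity
    by_cases h1 : |x| ≤ 1
    · have := Complex.norm_exp_sub_one_sub_id_le (x := Complex.I * x) (by rwa [hn])
      rw [hn, sq_abs] at this
      nlinarith [sq_nonneg ‖s‖, mul_nonneg (sq_nonneg ‖s‖) hs]
    · push Not at h1
      have h2 : |x| ≤ x ^ 2 := by rw [← sq_abs]; nlinarith
      have h3 : ‖Complex.exp (Complex.I * x) - 1 - Complex.I * x‖ ≤ 1 + 1 + |x| := by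
        refine (norm_sub_le _ _).trans ?_
        rw [hn]
        gcongr
        refine (norm_sub_le _ _).trans ?_
        rw [hexp, norm_one]
      nlinarith [mul_nonneg (sq_nonneg ‖s‖) hs]
  · push Not at hu
    have hmin : min 1 (‖u‖ ^ 2) = 1 := min_eq_left (one_le_pow₀ hu.le)
    rw [levyIntegrand, Set.indicator_of_notMem (show u ∉ {u : E | ‖u‖ ≤ 1} by simpa using hu),
      sub_zero, hmin]
    refine (norm_sub_le _ _).trans ?_
    rw [hexp, norm_one]
    nlinarith [sq_nonneg ‖s‖]

lemma measurable_levyIntegrand [SecondCountableTopology E] (s : E) :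
    Measurable (levyIntegrand s) := by
  unfold levyIntegrand
  refine Measurable.sub (by fun_prop) (Measurable.indicator (by fun_prop) ?_)
  exact measurableSet_le measurable_norm measurable_const

lemma IsLevyMeasure.integrable_levyIntegrand [SecondCountableTopology E] {ν : Measure E}
    (hν : IsLevyMeasure ν) (s : E) : Integrable (levyIntegrand s) ν := by
  refine (hν.integrable.const_mul (2 + 3 * ‖s‖ ^ 2)).mono
    (measurable_levyIntegrand s).aestronglyMeasurable (Filter.Eventually.of_forall fun u => ?_)
  refine (norm_levyIntegrand_le s u).trans (le_abs_self _)

lemma IsLevyMeasure.tendsto_setIntegral_levyIntegrand [SecondCountableTopology E]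
    {ν : Measure E} (hν : IsLevyMeasure ν) (s : E) :
    Filter.Tendsto (fun n => ∫ u in largeJumps E n, levyIntegrand s u ∂ν) Filter.atTop
      (nhds (∫ u, levyIntegrand s u ∂ν)) := by
  have h := tendsto_setIntegral_of_monotone (μ := ν) (f := levyIntegrand s)
    (fun n => measurableSet_largeJumps (E := E) n) monotone_largeJumps
    (hν.integrable_levyIntegrand s).integrableOn
  rw [iUnion_largeJumps, Measure.restrict_eq_self_of_ae_mem] at h
  · exact h
  · rw [ae_iff]
    simpa using hν.zero_atom

omit [InnerProductSpace ℝ E] in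
lemma jumpExponent_eq_integral [NormedSpace ℝ E] [SecondCountableTopology E] (ρ : Measure E)
    [IsFiniteMeasure ρ] (L : StrongDual ℝ E) :
    jumpExponent ρ L = ∫ u, (Complex.exp (L u * Complex.I) - 1) ∂ρ := by
  rw [jumpExponent, charFunDual_apply, integral_sub _ (integrable_const _)]
  · simp
  · exact (integrable_const (1 : ℝ)).mono (by fun_prop) (by simp)

omit [InnerProductSpace ℝ E] in
lemma jumpExponent_add [NormedSpace ℝ E] [SecondCountableTopology E] (A B : Measure E)
    [IsFiniteMeasure A] [IsFiniteMeasure B] (L : StrongDual ℝ E) :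
    jumpExponent (A + B) L = jumpExponent A L + jumpExponent B L := by
  simpa using jumpExponent_smul_add_smul A B zero_le_one zero_le_one L

omit [InnerProductSpace ℝ E] in
lemma jumpExponent_map [NormedSpace ℝ E] {F : Type*} [NormedAddCommGroup F] [NormedSpace ℝ F]
    [MeasurableSpace F] [BorelSpace F] (ρ : Measure E) (T : E →L[ℝ] F) (L : StrongDual ℝ F) :
    jumpExponent (ρ.map T) L = jumpExponent ρ (L.comp T) := by
  rw [jumpExponent, jumpExponent, charFunDual_map, Measure.real,
    Measure.map_apply (by fun_prop) MeasurableSet.univ]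
  rfl

variable [FiniteDimensional ℝ E]

/-- The compensating drift of the jumps of size between `1 / (n + 1)` and `1`. -/
noncomputable def compensator (ν : Measure E) (n : ℕ) : E :=
  ∫ u in largeJumps E n, Set.indicator {u : E | ‖u‖ ≤ 1} id u ∂ν

/-- Away from the origin the measure is finite, so the compensating term is integrable by itself and
can be detached as a drift. -/
lemma jumpExponent_largeJumps {ν : Measure E} (hν : IsLevyMeasure ν) (n : ℕ) (s : E) :
    jumpExponent (ν.restrict (largeJumps E n)) (innerSL ℝ s) =
      (∫ u in largeJumps E n, levyIntegrand s u ∂ν) +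
        Complex.I * (inner ℝ s (compensator ν n) : ℝ) := by
  have hfin := hν.isFiniteMeasure_restrict n
  have hball : MeasurableSet {u : E | ‖u‖ ≤ 1} := measurableSet_le measurable_norm measurable_const
  have hint : Integrable (Set.indicator {u : E | ‖u‖ ≤ 1} id)
      (ν.restrict (largeJumps E n)) := by
    refine (integrable_const (1 : ℝ)).mono
      (measurable_id.indicator hball).aestronglyMeasurable (Filter.Eventually.of_forall fun u => ?_)
    rw [norm_one]
    by_cases hu : u ∈ {u : E | ‖u‖ ≤ 1}
    · rw [Set.indicator_of_mem hu]; exact hu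
    · rw [Set.indicator_of_notMem hu]; simp
  have h1 : (inner ℝ s (compensator ν n) : ℝ) =
      ∫ u in largeJumps E n, inner ℝ s (Set.indicator {u : E | ‖u‖ ≤ 1} id u) ∂ν :=
    (integral_inner hint s).symm
  have h2 := hint.const_inner (𝕜 := ℝ) s
  have h3 : Integrable (fun u => Complex.I *
      ((inner ℝ s (Set.indicator {u : E | ‖u‖ ≤ 1} id u) : ℝ) : ℂ))
      (ν.restrict (largeJumps E n)) := h2.ofReal.const_mul _
  rw [jumpExponent_eq_integral, h1, ← integral_complex_ofReal, ← integral_const_mul,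
    ← integral_add (hν.integrable_levyIntegrand s).integrableOn h3]
  refine integral_congr_ae (Filter.Eventually.of_forall fun u => ?_)
  simp only [levyIntegrand, innerSL_apply_apply]
  by_cases hu : u ∈ {u : E | ‖u‖ ≤ 1}
  · simp [Set.indicator_of_mem hu, mul_comm]
  · simp [Set.indicator_of_notMem hu, mul_comm]

/-- A pointwise limit of characteristic functions that is continuous at `0` is a characteristic
function. -/
lemma exists_charFun_eq_of_tendsto {μ : ℕ → Measure E} [∀ i, IsProbabilityMeasure (μ i)]
    {f : E → ℂ} (hf : ContinuousAt f 0)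
    (h : ∀ t, Filter.Tendsto (fun n => charFun (μ n) t) Filter.atTop (nhds (f t))) :
    ∃ R : Measure E, IsProbabilityMeasure R ∧ ∀ t, charFun R t = f t := by
  have ht := isTightMeasureSet_of_tendsto_charFun hf h
  let m : ℕ → ProbabilityMeasure E := fun n => ⟨μ n, inferInstance⟩
  have hc : IsCompact (closure (Set.range m)) := by
    refine isCompact_closure_of_isTightMeasureSet ?_
    convert ht using 1
    ext x
    exact ⟨fun ⟨_, ⟨k, hk⟩, hx⟩ => ⟨k, by rw [← hx, ← hk]; rfl⟩,
      fun ⟨k, hk⟩ => ⟨m k, ⟨k, rfl⟩, hk⟩⟩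
  -- Tightness gives a compact closure, hence a limit along a free ultrafilter; no subsequence has
  -- to be extracted.
  let U : Ultrafilter ℕ := Filter.hyperfilter ℕ
  have hU : (U : Filter ℕ) ≤ Filter.atTop := Nat.hyperfilter_le_atTop
  obtain ⟨R, -, hR⟩ := hc.ultrafilter_le_nhds (U.map m)
    (.trans (by simp) (Filter.monotone_principal subset_closure))
  have hR' : Filter.Tendsto m U (nhds R) := hR
  refine ⟨R, inferInstance, fun t => ?_⟩
  rw [ProbabilityMeasure.tendsto_iff_forall_integral_rclike_tendsto ℂ] at hR'
  have h1 := hR' (BoundedContinuousFunction.innerProbChar t)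
  have h2 := (h t).mono_left hU
  simp_rw [charFun_eq_integral_innerProbChar] at h2 ⊢
  exact tendsto_nhds_unique h1 h2

lemma charFun_compoundPoisson (ρ : Measure E) [IsFiniteMeasure ρ] (s : E) :
    charFun (compoundPoisson ρ) s = Complex.exp (jumpExponent ρ (innerSL ℝ s)) := by
  rw [charFun_eq_charFunDual_toDualMap]
  exact charFunDual_compoundPoisson ρ _

/-- The large jumps of an infinitely divisible law split off as an independent summand. -/
lemma exists_conv_compoundPoisson_eq {ν μ : Measure E} {γ : E} (hν : IsLevyMeasure ν)
    [IsProbabilityMeasure μ] (hμ : ∀ t, charFun μ t = Complex.exp (levyExponent γ ν t)) (n : ℕ) :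
    ∃ R : Measure E, IsProbabilityMeasure R ∧
      R.conv (compoundPoisson (ν.restrict (largeJumps E n))) = μ := by
  have hfin := hν.isFiniteMeasure_restrict
  have hfin' : ∀ m, IsFiniteMeasure (ν.restrict (largeJumps E (n + m) \ largeJumps E n)) :=
    fun m => isFiniteMeasure_of_le (ν.restrict (largeJumps E (n + m)))
      (Measure.restrict_mono Set.sdiff_subset le_rfl)
  let κ : E → ℂ := fun s => jumpExponent (ν.restrict (largeJumps E n)) (innerSL ℝ s)
  -- Approximations of the remainder: jumps of size between 1/(n+m+1) and 1/(n+1), with a drift that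
  -- compensates all jumps down to 1/(n+m+1), including the large ones removed from the law.
  let P : ℕ → Measure E := fun m =>
    (compoundPoisson (ν.restrict (largeJumps E (n + m) \ largeJumps E n))).conv
      (Measure.dirac (γ - compensator ν (n + m)))
  have hP : ∀ m, IsProbabilityMeasure (P m) := fun m => by
    simp only [P]
    infer_instance
  have hsplit : ∀ m s, charFun (P m) s = Complex.exp ((∫ u in largeJumps E (n + m),
      levyIntegrand s u ∂ν) + Complex.I * (inner ℝ s γ : ℝ) - κ s) := by
    intro m s
    have h1 : ν.restrict (largeJumps E (n + m)) = ν.restrict (largeJumps E n) +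
        ν.restrict (largeJumps E (n + m) \ largeJumps E n) := by
      rw [← Measure.restrict_union Set.disjoint_sdiff_right
        ((measurableSet_largeJumps _).diff (measurableSet_largeJumps _)),
        Set.union_sdiff_cancel (monotone_largeJumps (Nat.le_add_right n m))]
    have h2 := jumpExponent_largeJumps hν (n + m) s
    rw [h1, jumpExponent_add, ← h1] at h2
    simp only [P]
    rw [charFun_conv, charFun_compoundPoisson, charFun_dirac, ← Complex.exp_add,
      real_inner_comm, inner_sub_right]
    congr 1
    push_cast
    simp only [κ]
    linear_combination h2
  have hlim : ∀ s, Filter.Tendsto (fun m => charFun (P m) s) Filter.atTop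
      (nhds (Complex.exp (levyExponent γ ν s - κ s))) := by
    intro s
    simp_rw [hsplit]
    refine (Complex.continuous_exp.tendsto _).comp (Filter.Tendsto.sub_const ?_ _)
    rw [levyExponent, add_comm]
    refine Filter.Tendsto.add_const _ ?_
    have h := hν.tendsto_setIntegral_levyIntegrand s
    simp_rw [add_comm n]
    exact h.comp (Filter.tendsto_add_atTop_nat n)
  -- The limit is a quotient of characteristic functions with nonvanishing denominator, so its
  -- continuity needs no estimate of the exponent.
  have hcont : ContinuousAt (fun s => Complex.exp (levyExponent γ ν s - κ s)) 0 := by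
    have heq : (fun s => Complex.exp (levyExponent γ ν s - κ s)) = fun s =>
        charFun μ s / charFun (compoundPoisson (ν.restrict (largeJumps E n))) s := by
      funext s
      rw [hμ, charFun_compoundPoisson, Complex.exp_sub]
    rw [heq]
    refine ContinuousAt.div (by fun_prop) (by fun_prop) ?_
    rw [charFun_compoundPoisson]
    exact Complex.exp_ne_zero _
  obtain ⟨R, hR, hRc⟩ := exists_charFun_eq_of_tendsto hcont hlim
  refine ⟨R, hR, Measure.ext_of_charFun (funext fun s => ?_)⟩
  rw [charFun_conv, hRc, charFun_compoundPoisson, hμ, ← Complex.exp_add]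
  simp [κ]

end LevyTriplet

/-! ### The coupling and the covariance representation. -/

section Coupling

variable {E : Type*} [NormedAddCommGroup E] [InnerProductSpace ℝ E] [MeasurableSpace E]
  [BorelSpace E] [FiniteDimensional ℝ E]

/-- The diagonal embedding. -/
noncomputable def diagCLM (E : Type*) [NormedAddCommGroup E] [InnerProductSpace ℝ E] :
    E →L[ℝ] E × E := (ContinuousLinearMap.id ℝ E).prod (ContinuousLinearMap.id ℝ E)

/-- The jumps of a pair of independent compound Poisson vectors with jump measure `ρ`. -/
noncomputable def independentJumps (ρ : Measure E) : Measure (E × E) :=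
  ρ.map (ContinuousLinearMap.inl ℝ E E) + ρ.map (ContinuousLinearMap.inr ℝ E E)

instance (ρ : Measure E) [IsFiniteMeasure ρ] : IsFiniteMeasure (independentJumps ρ) := by
  unfold independentJumps
  infer_instance

lemma jumpExponent_independentJumps (ρ : Measure E) [IsFiniteMeasure ρ]
    (L : StrongDual ℝ (E × E)) :
    jumpExponent (independentJumps ρ) L = jumpExponent ρ (L.comp (.inl ℝ E E)) +
      jumpExponent ρ (L.comp (.inr ℝ E E)) := by
  rw [independentJumps, jumpExponent_add, jumpExponent_map, jumpExponent_map]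

omit [BorelSpace E] [FiniteDimensional ℝ E] in
lemma jumpExponent_zero (ρ : Measure E) : jumpExponent ρ (0 : StrongDual ℝ E) = 0 := by
  simp [jumpExponent, charFunDual_apply]

/-- If the jumps are interpolated between common and independent ones, then each marginal stays the
same. -/
lemma map_conv_map_diagCLM_eq {ρ μ R : Measure E} {M : Measure (E × E)} [IsFiniteMeasure ρ]
    [IsProbabilityMeasure μ] [IsProbabilityMeasure R] [IsProbabilityMeasure M]
    (hR : R.conv (compoundPoisson ρ) = μ)
    (hM : ∀ L : StrongDual ℝ (E × E), charFunDual M L = ∫ z in (0 : ℝ)..1,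
      Complex.exp (z * jumpExponent (ρ.map (diagCLM E)) L +
        ((1 - z : ℝ) : ℂ) * jumpExponent (independentJumps ρ) L))
    (T : E × E →L[ℝ] E) (hT : T.comp (diagCLM E) = .id ℝ E)
    (hT' : ∀ L : StrongDual ℝ E, jumpExponent (independentJumps ρ) (L.comp T) =
      jumpExponent ρ L) :
    (M.conv (R.map (diagCLM E))).map T = μ := by
  have hQ : IsProbabilityMeasure (R.map (diagCLM E)) :=
    Measure.isProbabilityMeasure_map (by fun_prop)
  refine Measure.ext_of_charFunDual (funext fun L => ?_)
  rw [← hR, charFunDual_conv, charFunDual_map, charFunDual_conv, charFunDual_map, hM,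
    charFunDual_compoundPoisson, jumpExponent_map, hT', ContinuousLinearMap.comp_assoc, hT,
    ContinuousLinearMap.comp_id, mul_comm]
  congr 1
  -- Seen through `T`, both ends of the segment are the same exponent, so the integrand does not
  -- depend on z.
  have : ∀ z : ℝ, (z : ℂ) * jumpExponent ρ L + ((1 - z : ℝ) : ℂ) * jumpExponent ρ L =
      jumpExponent ρ L := fun z => by push_cast; ring
  simp_rw [this]
  simp

/-- `E × E` carries the sup norm; `WithLp 2` supplies the inner product in which convergence of
characteristic functions yields weak convergence. -/
lemma charFun_map_toLp_prod (m : Measure (E × E)) (t : WithLp 2 (E × E)) :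
    charFun (m.map (WithLp.toLp 2)) t =
      charFunDual m ((innerSL ℝ t.fst).coprod (innerSL ℝ t.snd)) := by
  rw [charFun_apply, charFunDual_apply, integral_map (by fun_prop) (by fun_prop)]
  refine integral_congr_ae (Filter.Eventually.of_forall fun p => ?_)
  simp [WithLp.prod_inner_apply, real_inner_comm]

/-- If only the jumps of size at most `1 / (n + 1)` are common, then the two copies become
independent as `n` tends to infinity. -/
lemma tendsto_integral_mul_independentJumps {ν μ : Measure E} {γ : E} (hν : IsLevyMeasure ν)
    [IsProbabilityMeasure μ] (hμ : ∀ t, charFun μ t = Complex.exp (levyExponent γ ν t))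
    (R : ℕ → Measure E) [∀ n, IsProbabilityMeasure (R n)]
    (hR : ∀ n, (R n).conv (compoundPoisson (ν.restrict (largeJumps E n))) = μ)
    (f g : BoundedContinuousFunction E ℝ) :
    Filter.Tendsto (fun n => ∫ p, f p.1 * g p.2
      ∂(compoundPoisson (independentJumps (ν.restrict (largeJumps E n)))).conv
        ((R n).map (diagCLM E))) Filter.atTop (nhds ((∫ x, f x ∂μ) * ∫ x, g x ∂μ)) := by
  have hfin := hν.isFiniteMeasure_restrict
  let m : ℕ → Measure (E × E) := fun n =>
    (compoundPoisson (independentJumps (ν.restrict (largeJumps E n)))).conv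
      ((R n).map (diagCLM E))
  have hQ : ∀ n, IsProbabilityMeasure ((R n).map (diagCLM E)) := fun n =>
    Measure.isProbabilityMeasure_map (by fun_prop)
  have hm : ∀ n, IsProbabilityMeasure (m n) := fun n => by simp only [m]; infer_instance
  let W : ℕ → ProbabilityMeasure (WithLp 2 (E × E)) := fun n =>
    ⟨(m n).map (WithLp.toLp 2), Measure.isProbabilityMeasure_map (by fun_prop)⟩
  let W₀ : ProbabilityMeasure (WithLp 2 (E × E)) :=
    ⟨(μ.prod μ).map (WithLp.toLp 2), Measure.isProbabilityMeasure_map (by fun_prop)⟩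
  have hW : Filter.Tendsto W Filter.atTop (nhds W₀) := by
    refine ProbabilityMeasure.tendsto_of_tendsto_charFun fun t => ?_
    simp only [W, W₀, ProbabilityMeasure.coe_mk, charFun_map_toLp_prod]
    set L := (innerSL ℝ t.fst).coprod (innerSL ℝ t.snd)
    have hinl : L.comp (.inl ℝ E E) = innerSL ℝ t.fst := by ext; simp [L]
    have hinr : L.comp (.inr ℝ E E) = innerSL ℝ t.snd := by ext; simp [L]
    have hdiag : L.comp (diagCLM E) = innerSL ℝ (t.fst + t.snd) := by
      ext x; simp [L, diagCLM]
    have hlim : charFunDual (μ.prod μ) L = Complex.exp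
        (levyExponent γ ν (t.fst + t.snd) - (∫ u, levyIntegrand (t.fst + t.snd) u ∂ν) +
          ((∫ u, levyIntegrand t.fst u ∂ν) + ∫ u, levyIntegrand t.snd u ∂ν)) := by
      have h1 : ∀ s, charFunDual μ (innerSL ℝ s) = charFun μ s := fun s =>
        (charFun_eq_charFunDual_toDualMap s).symm
      rw [charFunDual_prod, hinl, hinr, h1, h1, hμ, hμ, ← Complex.exp_add]
      congr 1
      simp only [levyExponent, levyIntegrand, inner_add_left]
      push_cast
      ring
    have hseq : ∀ n, charFunDual (m n) L = Complex.exp (levyExponent γ ν (t.fst + t.snd) -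
        (∫ u in largeJumps E n, levyIntegrand (t.fst + t.snd) u ∂ν) +
          ((∫ u in largeJumps E n, levyIntegrand t.fst u ∂ν) +
            ∫ u in largeJumps E n, levyIntegrand t.snd u ∂ν)) := by
      intro n
      have h2 : charFunDual (R n) (innerSL ℝ (t.fst + t.snd)) = Complex.exp
          (levyExponent γ ν (t.fst + t.snd) -
            jumpExponent (ν.restrict (largeJumps E n)) (innerSL ℝ (t.fst + t.snd))) := by
        rw [Complex.exp_sub, eq_div_iff (Complex.exp_ne_zero _), ← charFunDual_compoundPoisson,
          ← charFunDual_conv, hR, ← hμ]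
        exact (charFun_eq_charFunDual_toDualMap _).symm
      simp only [m]
      rw [charFunDual_conv, charFunDual_map, hdiag, h2, charFunDual_compoundPoisson,
        jumpExponent_independentJumps, hinl, hinr, ← Complex.exp_add,
        jumpExponent_largeJumps hν, jumpExponent_largeJumps hν, jumpExponent_largeJumps hν]
      -- The three compensators cancel, because the inner product is additive in `t.fst + t.snd`.
      congr 1
      simp only [inner_add_left]
      push_cast
      ring
    rw [hlim]
    simp_rw [hseq]
    refine (Complex.continuous_exp.tendsto _).comp ?_
    exact (tendsto_const_nhds.sub (hν.tendsto_setIntegral_levyIntegrand _)).add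
      ((hν.tendsto_setIntegral_levyIntegrand _).add (hν.tendsto_setIntegral_levyIntegrand _))
  let G : BoundedContinuousFunction (WithLp 2 (E × E)) ℝ :=
    f.compContinuous ⟨fun p => p.fst, by fun_prop⟩ *
      g.compContinuous ⟨fun p => p.snd, by fun_prop⟩
  have hG := (ProbabilityMeasure.tendsto_iff_forall_integral_tendsto.1 hW) G
  have hint : ∀ k : Measure (E × E), ∫ q, G q ∂(k.map (WithLp.toLp 2)) =
      ∫ p, f p.1 * g p.2 ∂k := by
    intro k
    rw [integral_map (by fun_prop) G.continuous.aestronglyMeasurable]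
    rfl
  simp only [W, W₀, ProbabilityMeasure.coe_mk, hint] at hG
  rwa [integral_prod_mul (fun x => f x) (fun x => g x)] at hG

/-- The covariance formula for the law `μ = R ∗ CP(ρ)`. -/
lemma integral_mul_sub_eq_integral_integral {ρ μ R : Measure E} {M : Measure (E × E)}
    [IsFiniteMeasure ρ] [IsProbabilityMeasure μ] [IsProbabilityMeasure R]
    [IsProbabilityMeasure M] (hR : R.conv (compoundPoisson ρ) = μ)
    (hM : ∀ L : StrongDual ℝ (E × E), charFunDual M L = ∫ z in (0 : ℝ)..1,
      Complex.exp (z * jumpExponent (ρ.map (diagCLM E)) L +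
        ((1 - z : ℝ) : ℂ) * jumpExponent (independentJumps ρ) L))
    (f g : BoundedContinuousFunction E ℝ) :
    ∫ u, ∫ p, (f (p.1 + u) - f p.1) * (g (p.2 + u) - g p.2) ∂(M.conv (R.map (diagCLM E))) ∂ρ =
      (∫ x, f x * g x ∂μ) - ∫ p, f p.1 * g p.2
        ∂(compoundPoisson (independentJumps ρ)).conv (R.map (diagCLM E)) := by
  have hQ : IsProbabilityMeasure (R.map (diagCLM E)) :=
    Measure.isProbabilityMeasure_map (by fun_prop)
  have hid := interpolation_identity (ρ.map (diagCLM E)) (independentJumps ρ) M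
    (R.map (diagCLM E)) hM
  -- When all jumps are common the two copies coincide.
  have hX : (compoundPoisson (ρ.map (diagCLM E))).conv (R.map (diagCLM E)) =
      μ.map (diagCLM E) := by
    refine Measure.ext_of_charFunDual (funext fun L => ?_)
    rw [charFunDual_conv, charFunDual_compoundPoisson, charFunDual_map, charFunDual_map, ← hR,
      charFunDual_conv, charFunDual_compoundPoisson, jumpExponent_map, mul_comm]
  rw [hX] at hid
  set Λ := M.conv (R.map (diagCLM E))
  let G : E × E → ℝ := fun p => f p.1 * g p.2
  have hGc : Continuous G := by fun_prop
  have hGb : ∀ p, ‖G p‖ ≤ ‖f‖ * ‖g‖ := fun p => by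
    rw [norm_mul]
    gcongr
    · exact f.norm_coe_le_norm _
    · exact g.norm_coe_le_norm _
  have hbdd : ∀ {α : Type _} [MeasurableSpace α] [TopologicalSpace α] [OpensMeasurableSpace α]
      [SecondCountableTopology α] (k : Measure α) [IsFiniteMeasure k] (T : α → E × E),
      Continuous T → Integrable (fun a => G (T a)) k := by
    intro α _ _ _ _ k _ T hT
    exact Integrable.of_bound (hGc.comp hT).aestronglyMeasurable (‖f‖ * ‖g‖)
      (Filter.Eventually.of_forall fun a => hGb _)
  have hGi : ∀ (k : Measure (E × E)) [IsFiniteMeasure k], Integrable G k := fun k _ =>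
    Integrable.of_bound hGc.aestronglyMeasurable (‖f‖ * ‖g‖) (Filter.Eventually.of_forall hGb)
  have f1 : IsFiniteMeasure ((ρ.map (diagCLM E)) Set.univ • Λ) :=
    Measure.smul_finite _ (measure_ne_top _ _)
  have f2 : IsFiniteMeasure ((independentJumps ρ) Set.univ • Λ) :=
    Measure.smul_finite _ (measure_ne_top _ _)
  have hunivA : (ρ.map (diagCLM E)) Set.univ = ρ Set.univ := by
    rw [Measure.map_apply (by fun_prop) MeasurableSet.univ, Set.preimage_univ]
  have hunivB : (independentJumps ρ) Set.univ = ρ Set.univ + ρ Set.univ := by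
    rw [independentJumps, Measure.add_apply, Measure.map_apply (by fun_prop) MeasurableSet.univ,
      Measure.map_apply (by fun_prop) MeasurableSet.univ, Set.preimage_univ, Set.preimage_univ]
  have hT : ∀ T : E →L[ℝ] E × E, ∫ p, G p ∂(Λ.conv (ρ.map T)) =
      ∫ q : E × (E × E), G (q.2 + T q.1) ∂(ρ.prod Λ) := by
    intro T
    rw [integral_conv (hGi _)]
    have : ∀ p, ∫ a, G (p + a) ∂(ρ.map T) = ∫ u, G (p + T u) ∂ρ := fun p =>
      integral_map (by fun_prop) (hGc.comp (by fun_prop)).aestronglyMeasurable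
    simp_rw [this]
    rw [integral_prod_symm (fun q : E × (E × E) => G (q.2 + T q.1))]
    exact hbdd (ρ.prod Λ) (fun q : E × (E × E) => q.2 + T q.1) (by fun_prop)
  have hconst : ∫ q : E × (E × E), G q.2 ∂(ρ.prod Λ) = (ρ Set.univ).toReal * ∫ p, G p ∂Λ := by
    rw [integral_fun_snd, smul_eq_mul]
    rfl
  have h := congrArg (fun k => ∫ p, G p ∂k) hid
  have hindep : Λ.conv (independentJumps ρ) = Λ.conv (ρ.map (ContinuousLinearMap.inl ℝ E E)) +
      Λ.conv (ρ.map (ContinuousLinearMap.inr ℝ E E)) := by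
    rw [independentJumps, Measure.conv_add]
  simp only [hindep] at h
  rw [integral_add_measure (hGi _) (hGi _), integral_add_measure (hGi _) (hGi _),
    integral_add_measure (hGi _) (hGi _), integral_add_measure (hGi _) (hGi _),
    integral_add_measure (hGi _) (hGi _), integral_smul_measure, integral_smul_measure, hunivA,
    hunivB, hT, hT, hT, integral_map (by fun_prop) hGc.aestronglyMeasurable,
    ENNReal.toReal_add (measure_ne_top _ _) (measure_ne_top _ _), smul_eq_mul, smul_eq_mul,
    add_mul, ← hconst] at h
  have e1 := hbdd (ρ.prod Λ) (fun q : E × (E × E) => q.2 + diagCLM E q.1) (by fun_prop)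
  have e2 := hbdd (ρ.prod Λ)
    (fun q : E × (E × E) => q.2 + ContinuousLinearMap.inl ℝ E E q.1) (by fun_prop)
  have e3 := hbdd (ρ.prod Λ)
    (fun q : E × (E × E) => q.2 + ContinuousLinearMap.inr ℝ E E q.1) (by fun_prop)
  have e4 := hbdd (ρ.prod Λ) (fun q : E × (E × E) => q.2) (by fun_prop)
  -- The diagonal jump comes from the common jump measure, the two one-sided jumps from the
  -- independent one. The last term has coefficient +1 because the independent measure has twice the
  -- mass of `ρ` and the common one has its mass once.
  have hrew : ∀ q : E × (E × E), (f (q.2.1 + q.1) - f q.2.1) * (g (q.2.2 + q.1) - g q.2.2) =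
      G (q.2 + diagCLM E q.1) - G (q.2 + ContinuousLinearMap.inl ℝ E E q.1) -
        G (q.2 + ContinuousLinearMap.inr ℝ E E q.1) + G q.2 := by
    intro q
    simp only [G, diagCLM, Prod.fst_add, Prod.snd_add, ContinuousLinearMap.prod_apply,
      ContinuousLinearMap.inl_apply, ContinuousLinearMap.inr_apply, ContinuousLinearMap.id_apply,
      add_zero]
    ring
  rw [← integral_prod (fun q : E × (E × E) =>
    (f (q.2.1 + q.1) - f q.2.1) * (g (q.2.2 + q.1) - g q.2.2))]
  · simp_rw [hrew]
    rw [integral_add (by exact (e1.sub e2).sub e3) e4, integral_sub (by exact e1.sub e2) e3,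
      integral_sub e1 e2]
    have hd : ∫ x, G (diagCLM E x) ∂μ = ∫ x, f x * g x ∂μ := rfl
    rw [hd] at h
    change _ = _ - ∫ p, G p ∂_
    linarith
  · simp_rw [hrew]
    exact ((e1.sub e2).sub e3).add e4

/-- **Covariance representation** for infinitely divisible laws without Gaussian component. -/
theorem exists_covariance_coupling {ν μ : Measure E} {γ : E} (hν : IsLevyMeasure ν)
    [IsProbabilityMeasure μ] (hμ : ∀ t, charFun μ t = Complex.exp (levyExponent γ ν t)) :
    ∃ Λ : ℕ → Measure (E × E), (∀ n, IsProbabilityMeasure (Λ n)) ∧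
      (∀ n, (Λ n).map Prod.fst = μ) ∧ (∀ n, (Λ n).map Prod.snd = μ) ∧
      ∀ f g : BoundedContinuousFunction E ℝ, Filter.Tendsto
        (fun n => ∫ u in largeJumps E n,
          ∫ p, (f (p.1 + u) - f p.1) * (g (p.2 + u) - g p.2) ∂(Λ n) ∂ν)
        Filter.atTop (nhds ((∫ x, f x * g x ∂μ) - (∫ x, f x ∂μ) * ∫ x, g x ∂μ)) := by
  have hfin := hν.isFiniteMeasure_restrict
  choose R hRp hR using exists_conv_compoundPoisson_eq hν hμ
  choose M hMp hM using fun n => exists_mixture_compoundPoisson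
    ((ν.restrict (largeJumps E n)).map (diagCLM E))
    (independentJumps (ν.restrict (largeJumps E n)))
  have hQ : ∀ n, IsProbabilityMeasure ((R n).map (diagCLM E)) := fun n =>
    Measure.isProbabilityMeasure_map (by fun_prop)
  refine ⟨fun n => (M n).conv ((R n).map (diagCLM E)), fun n => inferInstance, fun n => ?_,
    fun n => ?_, fun f g => ?_⟩
  · refine map_conv_map_diagCLM_eq (hR n) (hM n) (ContinuousLinearMap.fst ℝ E E) (by ext; rfl)
      fun L => ?_
    have h1 : (L.comp (ContinuousLinearMap.fst ℝ E E)).comp (.inl ℝ E E) = L := by ext; simp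
    have h2 : (L.comp (ContinuousLinearMap.fst ℝ E E)).comp (.inr ℝ E E) = 0 := by ext; simp
    rw [jumpExponent_independentJumps, h1, h2, jumpExponent_zero, add_zero]
  · refine map_conv_map_diagCLM_eq (hR n) (hM n) (ContinuousLinearMap.snd ℝ E E) (by ext; rfl)
      fun L => ?_
    have h1 : (L.comp (ContinuousLinearMap.snd ℝ E E)).comp (.inl ℝ E E) = 0 := by ext; simp
    have h2 : (L.comp (ContinuousLinearMap.snd ℝ E E)).comp (.inr ℝ E E) = L := by ext; simp
    rw [jumpExponent_independentJumps, h1, h2, jumpExponent_zero, zero_add]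
  · have h := (tendsto_integral_mul_independentJumps hν hμ R hR f g).const_sub
      (∫ x, f x * g x ∂μ)
    refine h.congr fun n => ?_
    exact (integral_mul_sub_eq_integral_integral (hR n) (hM n) f g).symm

end Coupling

/-! ### Entropy and convexity inequalities. -/

section Entropy

variable {α : Type*} [MeasurableSpace α]

lemma integral_exp_pos_of_bdd {μ : Measure α} [IsProbabilityMeasure μ] {h : α → ℝ}
    (hm : Measurable h) {K : ℝ} (hK : ∀ x, |h x| ≤ K) :
    Integrable (fun x => Real.exp (h x)) μ ∧ 0 < ∫ x, Real.exp (h x) ∂μ := by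
  have hi : Integrable (fun x => Real.exp (h x)) μ := by
    refine Integrable.of_bound hm.exp.aestronglyMeasurable (Real.exp K)
      (Filter.Eventually.of_forall fun x => ?_)
    rw [Real.norm_eq_abs, Real.abs_exp, Real.exp_le_exp]
    exact (le_abs_self _).trans (hK x)
  exact ⟨hi, integral_exp_pos hi⟩

/-- The entropy inequality. -/
lemma integral_exp_mul_le_entropy (μ : Measure α) [IsProbabilityMeasure μ] {h V : α → ℝ}
    (hm : Measurable h) (hV : Measurable V) {K : ℝ} (hK : ∀ x, |h x| ≤ K)
    (hKV : ∀ x, |V x| ≤ K) :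
    ∫ x, Real.exp (h x) * V x ∂μ ≤ (∫ x, Real.exp (h x) * h x ∂μ) -
      (∫ x, Real.exp (h x) ∂μ) * Real.log (∫ x, Real.exp (h x) ∂μ) +
      (∫ x, Real.exp (h x) ∂μ) * Real.log (∫ x, Real.exp (V x) ∂μ) := by
  obtain ⟨hi, hpos⟩ := integral_exp_pos_of_bdd (μ := μ) hm hK
  obtain ⟨hiV, hposV⟩ := integral_exp_pos_of_bdd (μ := μ) hV hKV
  set a := Real.log (∫ x, Real.exp (h x) ∂μ) with ha
  set c := Real.log (∫ x, Real.exp (V x) ∂μ) with hc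
  have hea : Real.exp a = ∫ x, Real.exp (h x) ∂μ := Real.exp_log hpos
  have hec : Real.exp c = ∫ x, Real.exp (V x) ∂μ := Real.exp_log hposV
  have i1 : Integrable (fun x => Real.exp (h x) * V x) μ :=
    hi.mul_bdd (c := K) hV.aestronglyMeasurable (Filter.Eventually.of_forall hKV)
  have i2 : Integrable (fun x => Real.exp (h x) * h x) μ :=
    hi.mul_bdd (c := K) hm.aestronglyMeasurable (Filter.Eventually.of_forall hK)
  have hle : ∫ x, Real.exp (h x) * V x ∂μ ≤ ∫ x, (Real.exp (h x) * h x +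
      (c - a - 1) * Real.exp (h x) + Real.exp (a - c) * Real.exp (V x)) ∂μ := by
    refine integral_mono i1 ((i2.add (hi.const_mul _)).add (hiV.const_mul _)) fun x => ?_
    -- The constants a and c normalise e^h and e^V to probability densities; the inequality is then
    -- 1 + y ≤ e^y for their log-ratio.
    have h1 := Real.add_one_le_exp (a - c + V x - h x)
    have h2 : Real.exp (a - c) * Real.exp (V x) =
        Real.exp (h x) * Real.exp (a - c + V x - h x) := by
      rw [← Real.exp_add, ← Real.exp_add]; congr 1; ring
    have h3 := mul_le_mul_of_nonneg_left h1 (Real.exp_pos (h x)).le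
    simp only
    rw [h2]
    linarith
  rw [integral_add (by exact i2.add (hi.const_mul _)) (hiV.const_mul _),
    integral_add i2 (hi.const_mul _), integral_const_mul, integral_const_mul, ← hea, ← hec,
    ← Real.exp_add, sub_add_cancel] at hle
  rw [← hea]
  linarith

/-- Jensen's inequality, by the tangent line of exp at the mean. It bounds the entropy of e^{tf} by
t times the covariance of f and e^{tf}. -/
lemma mul_integral_le_log_integral_exp (μ : Measure α) [IsProbabilityMeasure μ] {h : α → ℝ}
    (hm : Measurable h) {K : ℝ} (hK : ∀ x, |h x| ≤ K) :
    ∫ x, h x ∂μ ≤ Real.log (∫ x, Real.exp (h x) ∂μ) := by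
  obtain ⟨hi, hpos⟩ := integral_exp_pos_of_bdd (μ := μ) hm hK
  have hih : Integrable h μ :=
    Integrable.of_bound hm.aestronglyMeasurable K (Filter.Eventually.of_forall hK)
  rw [Real.le_log_iff_exp_le hpos]
  set m := ∫ x, h x ∂μ with hmdef
  have h1 : ∫ x, Real.exp m * (h x + (1 - m)) ∂μ ≤ ∫ x, Real.exp (h x) ∂μ := by
    refine integral_mono ((hih.add (integrable_const _)).const_mul _) hi fun x => ?_
    have h2 := Real.add_one_le_exp (h x - m)
    have h3 : Real.exp (h x) = Real.exp m * Real.exp (h x - m) := by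
      rw [← Real.exp_add]; congr 1; ring
    simp only
    rw [h3]
    gcongr
    linarith
  rw [integral_const_mul, integral_add hih (integrable_const _), ← hmdef] at h1
  simpa using h1

/-- The positive side is the worse one, |e^x - 1| ≤ e^{|x|} - 1, and convexity keeps exp below its
chord over [0, tw]. -/
lemma abs_exp_mul_sub_one_le {t w a : ℝ} (ht : 0 ≤ t) (hw : 0 < w) (ha : |a| ≤ w) :
    |Real.exp (t * a) - 1| ≤ (Real.exp (t * w) - 1) / w * |a| := by
  have h1 : |Real.exp (t * a) - 1| ≤ Real.exp (t * |a|) - 1 := by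
    rcases le_total 0 a with h | h
    · rw [abs_of_nonneg h, abs_of_nonneg]
      simpa using mul_nonneg ht h
    · rw [abs_of_nonpos h, abs_of_nonpos (by simpa using mul_nonpos_of_nonneg_of_nonpos ht h)]
      have h2 := Real.add_one_le_exp (t * a)
      have h3 := Real.add_one_le_exp (t * -a)
      linarith
  have h4 := convexOn_exp.2 (Set.mem_univ (0 : ℝ)) (Set.mem_univ (t * w))
    (sub_nonneg.2 ((div_le_one hw).2 ha)) (div_nonneg (abs_nonneg a) hw.le) (by ring)
  have h5 : (1 - |a| / w) • (0 : ℝ) + (|a| / w) • (t * w) = t * |a| := by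
    simp only [smul_eq_mul]
    field_simp
    ring
  rw [h5] at h4
  simp only [smul_eq_mul, Real.exp_zero] at h4
  have h6 : (Real.exp (t * w) - 1) / w * |a| =
      (1 - |a| / w) * 1 + |a| / w * Real.exp (t * w) - 1 := by
    field_simp
    ring
  linarith

end Entropy

/-! ### Increments along the axes. -/

section Increments

variable {d : ℕ}

/-- The squared increments of `f` of size `u` along the axes, divided by `u ^ 2`. -/
noncomputable def squaredIncrements (f : EuclideanSpace ℝ (Fin d) → ℝ) (u : ℝ)
    (x : EuclideanSpace ℝ (Fin d)) : ℝ :=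
  (∑ k : Fin d, (f (x + EuclideanSpace.single k u) - f x) ^ 2) / u ^ 2

lemma squaredIncrements_nonneg (f : EuclideanSpace ℝ (Fin d) → ℝ) (u : ℝ)
    (x : EuclideanSpace ℝ (Fin d)) : 0 ≤ squaredIncrements f u x :=
  div_nonneg (Finset.sum_nonneg fun _ _ => sq_nonneg _) (sq_nonneg _)

lemma continuous_squaredIncrements {f : EuclideanSpace ℝ (Fin d) → ℝ} (hf : Continuous f)
    (u : ℝ) : Continuous (squaredIncrements f u) := by
  unfold squaredIncrements
  fun_prop

lemma squaredIncrements_le {f : EuclideanSpace ℝ (Fin d) → ℝ} {b u : ℝ} (hu : u ≠ 0)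
    (hf : ∀ (k : Fin d) (u : ℝ) (x : EuclideanSpace ℝ (Fin d)),
      |f (x + EuclideanSpace.single k u) - f x| ≤ b * |u|) (x : EuclideanSpace ℝ (Fin d)) :
    squaredIncrements f u x ≤ d * b ^ 2 := by
  rw [squaredIncrements, div_le_iff₀ (by positivity)]
  calc ∑ k : Fin d, (f (x + EuclideanSpace.single k u) - f x) ^ 2
      ≤ ∑ k : Fin d, (b * |u|) ^ 2 := by
        gcongr ∑ k, ?_ with k
        rw [← sq_abs]
        gcongr
        exact hf k u x
    _ = d * b ^ 2 * u ^ 2 := by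
        rw [Finset.sum_const, Finset.card_univ, Fintype.card_fin, mul_pow, sq_abs]
        simp only [nsmul_eq_mul]
        ring

/-- Change one coordinate at a time and telescope. Continuity and linear growth of `f` follow. -/
lemma abs_sub_le_of_increments {f : EuclideanSpace ℝ (Fin d) → ℝ} {b : ℝ}
    (hf : ∀ (k : Fin d) (u : ℝ) (x : EuclideanSpace ℝ (Fin d)),
      |f (x + EuclideanSpace.single k u) - f x| ≤ b * |u|) (x v : EuclideanSpace ℝ (Fin d)) :
    |f (x + v) - f x| ≤ ∑ k, b * |v k| := by
  have key : ∀ s : Finset (Fin d),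
      |f (x + ∑ k ∈ s, EuclideanSpace.single k (v k)) - f x| ≤ ∑ k ∈ s, b * |v k| := by
    intro s
    induction s using Finset.induction_on with
    | empty => simp
    | insert k s hk ih =>
      rw [Finset.sum_insert hk, Finset.sum_insert hk]
      have h1 := hf k (v k) (x + ∑ k ∈ s, EuclideanSpace.single k (v k))
      rw [add_comm (EuclideanSpace.single k (v k)), ← add_assoc]
      refine (abs_sub_le _ (f (x + ∑ k ∈ s, EuclideanSpace.single k (v k))) _).trans ?_
      gcongr
  have hv : ∑ k, EuclideanSpace.single k (v k) = v := by
    ext j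
    simp [Finset.sum_apply]
  simpa [hv] using key Finset.univ

lemma continuous_of_increments {f : EuclideanSpace ℝ (Fin d) → ℝ} {b : ℝ}
    (hf : ∀ (k : Fin d) (u : ℝ) (x : EuclideanSpace ℝ (Fin d)),
      |f (x + EuclideanSpace.single k u) - f x| ≤ b * |u|) : Continuous f := by
  rw [continuous_iff_continuousAt]
  intro x
  rw [ContinuousAt, tendsto_iff_dist_tendsto_zero]
  have hlim : Filter.Tendsto (fun y : EuclideanSpace ℝ (Fin d) => ∑ k, b * |(y - x) k|)
      (nhds x) (nhds 0) := by
    have hc : Continuous fun y : EuclideanSpace ℝ (Fin d) => ∑ k, b * |(y - x) k| := by fun_prop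
    have := hc.tendsto x
    simpa using this
  refine squeeze_zero (fun _ => dist_nonneg) (fun y => ?_) hlim
  have := abs_sub_le_of_increments hf x (y - x)
  rwa [add_sub_cancel] at this

/-- Factor out e^{tf(z)}, linearise e^{tB} - 1 with slope (e^{tb|u|} - 1)/(b|u|), and decouple y
from z by AM–GM. The u² extracted by `squaredIncrements` turns the slope into the weight
|u|(e^{tb|u|} - 1)/b. -/
lemma sum_mul_increments_le {f : EuclideanSpace ℝ (Fin d) → ℝ} {b t u : ℝ} (hb : 0 < b)
    (ht : 0 ≤ t) (hu : u ≠ 0)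
    (hf : ∀ (k : Fin d) (u : ℝ) (x : EuclideanSpace ℝ (Fin d)),
      |f (x + EuclideanSpace.single k u) - f x| ≤ b * |u|) (y z : EuclideanSpace ℝ (Fin d)) :
    ∑ k, (f (y + EuclideanSpace.single k u) - f y) *
        (Real.exp (t * f (z + EuclideanSpace.single k u)) - Real.exp (t * f z)) ≤
      |u| * ((Real.exp (t * b * |u|) - 1) / b) * (2⁻¹ *
        (Real.exp (t * f z) * squaredIncrements f u y +
          Real.exp (t * f z) * squaredIncrements f u z)) := by
  have hw : 0 < b * |u| := mul_pos hb (abs_pos.2 hu)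
  set κ := (Real.exp (t * (b * |u|)) - 1) / (b * |u|) with hκ
  have hκ0 : 0 ≤ κ := div_nonneg (by simpa using mul_nonneg ht hw.le) hw.le
  have hterm : ∀ k, (f (y + EuclideanSpace.single k u) - f y) *
        (Real.exp (t * f (z + EuclideanSpace.single k u)) - Real.exp (t * f z)) ≤
      Real.exp (t * f z) * κ * (2⁻¹ * ((f (y + EuclideanSpace.single k u) - f y) ^ 2 +
        (f (z + EuclideanSpace.single k u) - f z) ^ 2)) := by
    intro k
    set A := f (y + EuclideanSpace.single k u) - f y
    set B := f (z + EuclideanSpace.single k u) - f z with hB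
    have h1 : Real.exp (t * f (z + EuclideanSpace.single k u)) - Real.exp (t * f z) =
        Real.exp (t * f z) * (Real.exp (t * B) - 1) := by
      rw [mul_sub, ← Real.exp_add, hB, mul_one]
      congr 2
      ring
    have h2 := abs_exp_mul_sub_one_le ht hw (hf k u z)
    rw [← hB, ← hκ] at h2
    rw [h1]
    calc A * (Real.exp (t * f z) * (Real.exp (t * B) - 1))
        ≤ |A| * (Real.exp (t * f z) * |Real.exp (t * B) - 1|) := by
          rw [← abs_of_pos (Real.exp_pos (t * f z)), ← abs_mul, ← abs_mul,
            abs_of_pos (Real.exp_pos (t * f z))]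
          exact le_abs_self _
      _ ≤ |A| * (Real.exp (t * f z) * (κ * |B|)) := by gcongr
      _ = Real.exp (t * f z) * κ * (|A| * |B|) := by ring
      _ ≤ Real.exp (t * f z) * κ * (2⁻¹ * (A ^ 2 + B ^ 2)) := by
          refine mul_le_mul_of_nonneg_left ?_ (by positivity)
          rw [← sq_abs A, ← sq_abs B]
          nlinarith [sq_nonneg (|A| - |B|)]
  refine (Finset.sum_le_sum fun k _ => hterm k).trans_eq ?_
  rw [← Finset.mul_sum, ← Finset.mul_sum, Finset.sum_add_distrib]
  have hu2 : u ^ 2 = |u| ^ 2 := (sq_abs u).symm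
  have hu' : |u| ≠ 0 := abs_ne_zero.2 hu
  simp only [squaredIncrements, hκ, hu2]
  rw [← mul_assoc t b]
  field_simp

/-- The covariance of `f` and `exp (t f)`. -/
noncomputable def expCov (μ : Measure (EuclideanSpace ℝ (Fin d)))
    (f : EuclideanSpace ℝ (Fin d) → ℝ) (t : ℝ) : ℝ :=
  (∫ x, f x * Real.exp (t * f x) ∂μ) - (∫ x, f x ∂μ) * ∫ x, Real.exp (t * f x) ∂μ

/-- The entropy inequality under `Λ` needs only the marginals, so the same bound holds with the
squared increments at either coordinate. The right side dominates a nonnegative integral, which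
gives its sign; this later allows the domain of integration to be enlarged. -/
lemma sum_integral_mul_increments_le {μ : Measure (EuclideanSpace ℝ (Fin d))}
    [IsProbabilityMeasure μ]
    {Λ : Measure (EuclideanSpace ℝ (Fin d) × EuclideanSpace ℝ (Fin d))} [IsProbabilityMeasure Λ]
    (hfst : Λ.map Prod.fst = μ) (hsnd : Λ.map Prod.snd = μ)
    (f : BoundedContinuousFunction (EuclideanSpace ℝ (Fin d)) ℝ) {b t u l φ : ℝ} (hb : 0 < b)
    (ht : 0 ≤ t) (hu : u ≠ 0) (hl : 0 < l)
    (hf : ∀ (k : Fin d) (u : ℝ) (x : EuclideanSpace ℝ (Fin d)),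
      |f (x + EuclideanSpace.single k u) - f x| ≤ b * |u|)
    (hφ : ∫ x, Real.exp (l * squaredIncrements f u x) ∂μ ≤ φ) :
    ∑ k, ∫ p, (f (p.1 + EuclideanSpace.single k u) - f p.1) *
        (Real.exp (t * f (p.2 + EuclideanSpace.single k u)) - Real.exp (t * f p.2)) ∂Λ ≤
      1 / l * |u| * ((Real.exp (t * b * |u|) - 1) / b) *
        (t * expCov μ f t + Real.log φ * ∫ x, Real.exp (t * f x) ∂μ) ∧
    0 ≤ 1 / l * |u| * ((Real.exp (t * b * |u|) - 1) / b) *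
        (t * expCov μ f t + Real.log φ * ∫ x, Real.exp (t * f x) ∂μ) := by
  have hfc : Continuous f := f.continuous
  have hDc := continuous_squaredIncrements hfc u
  let K : ℝ := max (t * ‖f‖) (l * (d * b ^ 2))
  have hKf : ∀ x, |t * f x| ≤ K := fun x => by
    rw [abs_mul, abs_of_nonneg ht]
    refine le_trans ?_ (le_max_left _ _)
    gcongr
    exact f.norm_coe_le_norm x
  have hKD : ∀ x, |l * squaredIncrements f u x| ≤ K := fun x => by
    rw [abs_of_nonneg (mul_nonneg hl.le (squaredIncrements_nonneg f u x))]
    refine le_trans ?_ (le_max_right _ _)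
    gcongr
    exact squaredIncrements_le hu hf x
  have hmarg : ∀ (T : EuclideanSpace ℝ (Fin d) × EuclideanSpace ℝ (Fin d) →
      EuclideanSpace ℝ (Fin d)), Continuous T → Λ.map T = μ →
      ∀ q : EuclideanSpace ℝ (Fin d) → ℝ, Continuous q →
        ∫ p, q (T p) ∂Λ = ∫ x, q x ∂μ := by
    intro T hT hTμ q hq
    rw [← hTμ, integral_map hT.aemeasurable hq.aestronglyMeasurable]
  obtain ⟨hiW, hposW⟩ := integral_exp_pos_of_bdd (μ := μ) (h := fun x => t * f x)
    (by fun_prop) hKf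
  obtain ⟨hiD, hposD⟩ := integral_exp_pos_of_bdd (μ := μ)
    (h := fun x => l * squaredIncrements f u x) (by fun_prop) hKD
  have hjensen := mul_integral_le_log_integral_exp μ (h := fun x => t * f x) (by fun_prop) hKf
  rw [integral_const_mul] at hjensen
  have hlog : Real.log (∫ x, Real.exp (l * squaredIncrements f u x) ∂μ) ≤ Real.log φ :=
    Real.log_le_log hposD hφ
  have hent : ∀ T : EuclideanSpace ℝ (Fin d) × EuclideanSpace ℝ (Fin d) →
      EuclideanSpace ℝ (Fin d), Continuous T → Λ.map T = μ →
      ∫ p, Real.exp (t * f p.2) * squaredIncrements f u (T p) ∂Λ ≤ 1 / l *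
        (t * expCov μ f t + Real.log φ * ∫ x, Real.exp (t * f x) ∂μ) := by
    intro T hT hTμ
    have h := integral_exp_mul_le_entropy Λ (h := fun p => t * f p.2)
      (V := fun p => l * squaredIncrements f u (T p)) (K := K) (by fun_prop)
      (hDc.measurable.comp hT.measurable |>.const_mul l) (fun p => hKf _) (fun p => hKD _)
    rw [hmarg T hT hTμ (fun x => Real.exp (l * squaredIncrements f u x)) (by fun_prop),
      hmarg Prod.snd continuous_snd hsnd (fun x => Real.exp (t * f x)) (by fun_prop),
      hmarg Prod.snd continuous_snd hsnd (fun x => Real.exp (t * f x) * (t * f x))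
        (by fun_prop)] at h
    have h1 : ∫ x, Real.exp (t * f x) * (t * f x) ∂μ = t * ∫ x, f x * Real.exp (t * f x) ∂μ := by
      rw [← integral_const_mul]
      refine integral_congr_ae (Filter.Eventually.of_forall fun x => ?_)
      simp only
      ring
    have h2 : ∫ p, Real.exp (t * f p.2) * (l * squaredIncrements f u (T p)) ∂Λ =
        l * ∫ p, Real.exp (t * f p.2) * squaredIncrements f u (T p) ∂Λ := by
      rw [← integral_const_mul]
      refine integral_congr_ae (Filter.Eventually.of_forall fun x => ?_)
      simp only
      ring
    rw [h1, h2] at h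
    rw [one_div, le_inv_mul_iff₀ hl]
    refine h.trans ?_
    rw [expCov]
    have h3 := mul_le_mul_of_nonneg_left hjensen hposW.le
    have h4 := mul_le_mul_of_nonneg_left hlog hposW.le
    linarith
  have hcoef : 0 ≤ |u| * ((Real.exp (t * b * |u|) - 1) / b) := by
    refine mul_nonneg (abs_nonneg u) (div_nonneg ?_ hb.le)
    rw [sub_nonneg, Real.one_le_exp_iff]
    positivity
  have hent1 := hent Prod.fst continuous_fst hfst
  have hent2 := hent Prod.snd continuous_snd hsnd
  have hnn : 0 ≤ ∫ p, Real.exp (t * f p.2) * squaredIncrements f u p.1 ∂Λ :=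
    integral_nonneg fun p => mul_nonneg (Real.exp_pos _).le (squaredIncrements_nonneg _ _ _)
  have hWle : ∀ x, Real.exp (t * f x) ≤ Real.exp K := fun x =>
    Real.exp_le_exp.2 ((le_abs_self _).trans (hKf x))
  have hintD : ∀ T : EuclideanSpace ℝ (Fin d) × EuclideanSpace ℝ (Fin d) →
      EuclideanSpace ℝ (Fin d), Continuous T →
      Integrable (fun p => Real.exp (t * f p.2) * squaredIncrements f u (T p)) Λ := by
    intro T hT
    refine Integrable.of_bound (C := Real.exp K * (d * b ^ 2))
      (Continuous.aestronglyMeasurable (by fun_prop)) (Filter.Eventually.of_forall fun p => ?_)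
    rw [norm_mul, Real.norm_eq_abs, Real.norm_eq_abs, Real.abs_exp,
      abs_of_nonneg (squaredIncrements_nonneg _ _ _)]
    exact mul_le_mul (hWle _) (squaredIncrements_le hu hf _) (squaredIncrements_nonneg _ _ _)
      (Real.exp_pos _).le
  have hassoc : ∀ r : ℝ, 1 / l * |u| * ((Real.exp (t * b * |u|) - 1) / b) * r =
      |u| * ((Real.exp (t * b * |u|) - 1) / b) * (1 / l * r) := fun r => by ring
  rw [hassoc]
  refine ⟨?_, mul_nonneg hcoef (hnn.trans hent1)⟩
  have hintS : ∀ k ∈ (Finset.univ : Finset (Fin d)), Integrable (fun p =>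
      (f (p.1 + EuclideanSpace.single k u) - f p.1) *
        (Real.exp (t * f (p.2 + EuclideanSpace.single k u)) - Real.exp (t * f p.2))) Λ := by
    intro k _
    refine Integrable.of_bound (C := b * |u| * (Real.exp K + Real.exp K))
      (Continuous.aestronglyMeasurable (by fun_prop)) (Filter.Eventually.of_forall fun p => ?_)
    rw [norm_mul]
    refine mul_le_mul (hf k u p.1) ((norm_sub_le _ _).trans ?_) (norm_nonneg _) (by positivity)
    rw [Real.norm_eq_abs, Real.norm_eq_abs, Real.abs_exp, Real.abs_exp]
    exact add_le_add (hWle _) (hWle _)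
  rw [← integral_finsetSum _ hintS]
  refine (integral_mono (integrable_finsetSum _ hintS)
    (((hintD _ continuous_fst).add (hintD _ continuous_snd)).const_mul _ |>.const_mul _)
    fun p => sum_mul_increments_le hb ht hu hf p.1 p.2).trans ?_
  simp only [Pi.add_apply]
  rw [integral_const_mul, integral_const_mul,
    integral_add (hintD _ continuous_fst) (hintD _ continuous_snd)]
  refine mul_le_mul_of_nonneg_left ?_ hcoef
  linarith

end Increments

/-! ### Bounded functions, and passage to the limit by truncation. -/

section Truncation

variable {d : ℕ}

lemma preimage_single_largeJumps (k : Fin d) (n : ℕ) :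
    (fun u : ℝ => EuclideanSpace.single k u) ⁻¹' largeJumps (EuclideanSpace ℝ (Fin d)) n =
      largeJumps ℝ n := by
  ext u
  change 1 / ((n : ℝ) + 1) < ‖EuclideanSpace.single k u‖ ↔ 1 / ((n : ℝ) + 1) < ‖u‖
  rw [PiLp.norm_single]

lemma measurable_single (k : Fin d) :
    Measurable fun u : ℝ => (EuclideanSpace.single k u : EuclideanSpace ℝ (Fin d)) := by
  have h : Isometry fun u : ℝ => (EuclideanSpace.single k u : EuclideanSpace ℝ (Fin d)) :=
    Isometry.of_dist_eq fun u v => PiLp.dist_single_same 2 (fun _ : Fin d => ℝ) k u v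
  exact h.continuous.measurable

lemma axisMeasure_restrict_largeJumps (ν' : Fin d → Measure ℝ) (n : ℕ) :
    (axisMeasure ν').restrict (largeJumps (EuclideanSpace ℝ (Fin d)) n) =
      ∑ k, ((ν' k).restrict (largeJumps ℝ n)).map (fun u : ℝ => EuclideanSpace.single k u) := by
  rw [axisMeasure, ← Measure.restrictₗ_apply, map_sum]
  refine Finset.sum_congr rfl fun k _ => ?_
  rw [Measure.restrictₗ_apply, Measure.restrict_map (measurable_single k)
    (measurableSet_largeJumps n), preimage_single_largeJumps]

lemma setIntegral_largeJumps_axisMeasure {ν' : Measure ℝ} {n : ℕ}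
    {G : EuclideanSpace ℝ (Fin d) → ℝ} (hG : Measurable G)
    (hi : Integrable G ((axisMeasure fun _ : Fin d => ν').restrict
      (largeJumps (EuclideanSpace ℝ (Fin d)) n))) :
    (∀ k, Integrable (fun u => G (EuclideanSpace.single k u))
      (ν'.restrict (largeJumps ℝ n))) ∧
    ∫ u in largeJumps (EuclideanSpace ℝ (Fin d)) n, G u ∂(axisMeasure fun _ : Fin d => ν') =
      ∑ k, ∫ u in largeJumps ℝ n, G (EuclideanSpace.single k u) ∂ν' := by
  rw [axisMeasure_restrict_largeJumps] at hi ⊢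
  have hi' := integrable_finsetSum_measure.1 hi
  refine ⟨fun k => ?_, ?_⟩
  · exact (integrable_map_measure hG.aestronglyMeasurable (measurable_single k).aemeasurable).1
      (hi' k (Finset.mem_univ k))
  · rw [integral_finsetSum_measure hi']
    refine Finset.sum_congr rfl fun k _ => ?_
    rw [integral_map (measurable_single k).aemeasurable hG.aestronglyMeasurable]

/-- The modified logarithmic Sobolev inequality for bounded functions. -/
lemma expCov_le_of_bounded {ν' : Measure ℝ} {μ : Measure (EuclideanSpace ℝ (Fin d))}
    [IsProbabilityMeasure μ] {γ : EuclideanSpace ℝ (Fin d)}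
    (hν : IsLevyMeasure (axisMeasure fun _ : Fin d => ν'))
    (hμ : ∀ s, charFun μ s = Complex.exp (levyExponent γ (axisMeasure fun _ : Fin d => ν') s))
    (f : BoundedContinuousFunction (EuclideanSpace ℝ (Fin d)) ℝ) {b t : ℝ} {l φ : ℝ → ℝ}
    (hb : 0 < b) (ht : 0 ≤ t) (hl : ∀ u, 0 < l u)
    (hf : ∀ (k : Fin d) (u : ℝ) (x : EuclideanSpace ℝ (Fin d)),
      |f (x + EuclideanSpace.single k u) - f x| ≤ b * |u|)
    (hφ : ∀ u, u ≠ 0 → ∫ x, Real.exp (l u * squaredIncrements f u x) ∂μ ≤ φ u)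
    (hh : Integrable (fun u => t / l u * |u| * ((Real.exp (t * b * |u|) - 1) / b)) ν')
    (hg : Integrable (fun u => Real.log (φ u) / l u * |u| * ((Real.exp (t * b * |u|) - 1) / b))
      ν') :
    expCov μ f t ≤ (∫ u, t / l u * |u| * ((Real.exp (t * b * |u|) - 1) / b) ∂ν') * expCov μ f t +
      (∫ u, Real.log (φ u) / l u * |u| * ((Real.exp (t * b * |u|) - 1) / b) ∂ν') *
        ∫ x, Real.exp (t * f x) ∂μ := by
  obtain ⟨Λ, hΛ, hfst, hsnd, hlim⟩ := exists_covariance_coupling hν hμ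
  have hWle : ∀ x, Real.exp (t * f x) ≤ Real.exp (t * ‖f‖) := fun x => by
    gcongr
    exact (le_abs_self _).trans (f.norm_coe_le_norm x)
  let g : BoundedContinuousFunction (EuclideanSpace ℝ (Fin d)) ℝ :=
    BoundedContinuousFunction.ofNormedAddCommGroup (fun x => Real.exp (t * f x)) (by fun_prop)
      (Real.exp (t * ‖f‖)) fun x => by
        rw [Real.norm_eq_abs, Real.abs_exp]; exact hWle x
  have hgx : ∀ x, g x = Real.exp (t * f x) := fun x => rfl
  let w : ℝ → ℝ := fun u => 1 / l u * |u| * ((Real.exp (t * b * |u|) - 1) / b)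
  set c := expCov μ f t with hc
  set I := ∫ x, Real.exp (t * f x) ∂μ
  let B : ℝ → ℝ := fun u => w u * (t * c + Real.log (φ u) * I)
  have hB : ∀ u, B u = t / l u * |u| * ((Real.exp (t * b * |u|) - 1) / b) * c +
      Real.log (φ u) / l u * |u| * ((Real.exp (t * b * |u|) - 1) / b) * I := fun u => by
    simp only [B, w]; ring
  have hBint : Integrable B ν' := by
    refine ((hh.mul_const c).add (hg.mul_const I)).congr
      (Filter.Eventually.of_forall fun u => ?_)
    exact (hB u).symm
  have hBval : ∫ u, B u ∂ν' =
      (∫ u, t / l u * |u| * ((Real.exp (t * b * |u|) - 1) / b) ∂ν') * c +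
      (∫ u, Real.log (φ u) / l u * |u| * ((Real.exp (t * b * |u|) - 1) / b) ∂ν') * I := by
    simp_rw [hB]
    rw [integral_add (hh.mul_const c) (hg.mul_const I), integral_mul_const, integral_mul_const]
  have hBle : ∀ (n : ℕ) (u : ℝ), u ≠ 0 → _ := fun n u hu => sum_integral_mul_increments_le (hfst n) (hsnd n) f
    hb ht hu (hl u) hf (hφ u hu)
  -- At u = 0 the weight vanishes; elsewhere the sign comes from the entropy bound.
  have hB0 : ∀ u, 0 ≤ B u := by
    intro u
    rcases eq_or_ne u 0 with rfl | hu
    · simp [B, w]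
    · exact (hBle 0 u hu).2
  rw [← hBval]
  have hlim' := hlim f g
  have hcov : (∫ x, f x * g x ∂μ) - (∫ x, f x ∂μ) * ∫ x, g x ∂μ = c := rfl
  rw [hcov] at hlim'
  -- The bound `∫ B` is independent of the cutoff n, so it suffices to prove it for each coupling `Λ
  -- n`.
  refine le_of_tendsto' hlim' fun n => ?_
  have hfin := hν.isFiniteMeasure_restrict n
  let H : EuclideanSpace ℝ (Fin d) → ℝ := fun u =>
    ∫ p, (f (p.1 + u) - f p.1) * (g (p.2 + u) - g p.2) ∂(Λ n)
  have hHm : Measurable H := by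
    have hcont : Continuous (Function.uncurry fun (u : EuclideanSpace ℝ (Fin d))
        (p : EuclideanSpace ℝ (Fin d) × EuclideanSpace ℝ (Fin d)) =>
        (f (p.1 + u) - f p.1) * (g (p.2 + u) - g p.2)) := by
      unfold Function.uncurry
      fun_prop
    exact (hcont.stronglyMeasurable.integral_prod_right (ν := Λ n)).measurable
  have hHb : ∀ u, ‖H u‖ ≤ (‖f‖ + ‖f‖) * (‖g‖ + ‖g‖) := by
    intro u
    refine (norm_integral_le_of_norm_le_const (C := (‖f‖ + ‖f‖) * (‖g‖ + ‖g‖))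
      (Filter.Eventually.of_forall fun p => ?_)).trans ?_
    · rw [norm_mul]
      refine mul_le_mul ((norm_sub_le _ _).trans ?_) ((norm_sub_le _ _).trans ?_)
        (norm_nonneg _) (by positivity)
      · exact add_le_add (f.norm_coe_le_norm _) (f.norm_coe_le_norm _)
      · exact add_le_add (g.norm_coe_le_norm _) (g.norm_coe_le_norm _)
    · simp
  have hHi : Integrable H ((axisMeasure fun _ : Fin d => ν').restrict
      (largeJumps (EuclideanSpace ℝ (Fin d)) n)) :=
    Integrable.of_bound hHm.aestronglyMeasurable _ (Filter.Eventually.of_forall hHb)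
  obtain ⟨hHk, hHsum⟩ := setIntegral_largeJumps_axisMeasure hHm hHi
  change ∫ u in largeJumps (EuclideanSpace ℝ (Fin d)) n, H u ∂_ ≤ _
  rw [hHsum, ← integral_finsetSum _ fun k _ => hHk k]
  calc ∫ u in largeJumps ℝ n, ∑ k, H (EuclideanSpace.single k u) ∂ν'
      ≤ ∫ u in largeJumps ℝ n, B u ∂ν' := by
        refine setIntegral_mono_on (integrable_finsetSum _ fun k _ => hHk k) hBint.integrableOn
          (measurableSet_largeJumps n) fun u hu => ?_
        have hu0 : u ≠ 0 := by
          have : u ∈ ⋃ m, largeJumps ℝ m := Set.mem_iUnion.2 ⟨n, hu⟩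
          rwa [iUnion_largeJumps] at this
        exact (hBle n u hu0).1
    _ ≤ ∫ u, B u ∂ν' := setIntegral_le_integral hBint (Filter.Eventually.of_forall hB0)

/-- The truncation of a continuous function at the levels `-n` and `n`. -/
noncomputable def truncate {E : Type*} [TopologicalSpace E] (f : E → ℝ) (hf : Continuous f)
    (n : ℕ) : BoundedContinuousFunction E ℝ :=
  BoundedContinuousFunction.ofNormedAddCommGroup (fun x => max (-(n : ℝ)) (min n (f x)))
    (by fun_prop) n fun x => by
      have : (0 : ℝ) ≤ n := Nat.cast_nonneg n
      rw [Real.norm_eq_abs, abs_le]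
      exact ⟨le_max_left _ _, max_le (by linarith) (min_le_left _ _)⟩

lemma truncate_apply {E : Type*} [TopologicalSpace E] (f : E → ℝ) (hf : Continuous f) (n : ℕ)
    (x : E) : truncate f hf n x = max (-(n : ℝ)) (min n (f x)) := rfl

/-- Clamping is 1-Lipschitz. Hence truncation preserves the bound b on increments and does not
increase the squared increments, so the same φ serves for every level. -/
lemma abs_truncate_sub_le {E : Type*} [TopologicalSpace E] (f : E → ℝ) (hf : Continuous f)
    (n : ℕ) (x y : E) : |truncate f hf n x - truncate f hf n y| ≤ |f x - f y| := by
  rw [truncate_apply, truncate_apply]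
  refine (abs_max_sub_max_le_max _ _ _ _).trans ?_
  rw [sub_self, abs_zero]
  refine max_le (abs_nonneg _) ((abs_min_sub_min_le_max _ _ _ _).trans ?_)
  rw [sub_self, abs_zero]
  exact max_le (abs_nonneg _) le_rfl

lemma tendsto_truncate {E : Type*} [TopologicalSpace E] (f : E → ℝ) (hf : Continuous f) (x : E) :
    Filter.Tendsto (fun n => truncate f hf n x) Filter.atTop (nhds (f x)) := by
  refine tendsto_const_nhds.congr' ?_
  obtain ⟨N, hN⟩ := exists_nat_ge |f x|
  filter_upwards [Filter.eventually_ge_atTop N] with n hn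
  have h1 : |f x| ≤ n := hN.trans (by exact_mod_cast hn)
  rw [truncate_apply, min_eq_right (abs_le.1 h1).2, max_eq_right (abs_le.1 h1).1]

lemma abs_truncate_le {E : Type*} [TopologicalSpace E] (f : E → ℝ) (hf : Continuous f) (n : ℕ)
    (x : E) : |truncate f hf n x| ≤ |f x| := by
  have h : (0 : ℝ) ≤ n := Nat.cast_nonneg n
  rw [truncate_apply, abs_le]
  rcases le_total 0 (f x) with hx | hx
  · rw [abs_of_nonneg hx]
    exact ⟨(by linarith : -f x ≤ 0).trans (le_max_of_le_right (le_min h hx)),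
      max_le (by linarith) (min_le_right _ _)⟩
  · rw [abs_of_nonpos hx, neg_neg]
    exact ⟨le_max_of_le_right (le_min (by linarith) le_rfl),
      max_le (by linarith) ((min_le_right _ _).trans (by linarith))⟩

/-- Truncation can raise `f` only where `f < 0`, and there the truncated value is at most 0; the
summand 1 covers this case. -/
lemma exp_mul_truncate_le {E : Type*} [TopologicalSpace E] (f : E → ℝ) (hf : Continuous f)
    {t : ℝ} (ht : 0 ≤ t) (n : ℕ) (x : E) :
    Real.exp (t * truncate f hf n x) ≤ Real.exp (t * f x) + 1 := by
  have h : (0 : ℝ) ≤ n := Nat.cast_nonneg n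
  rcases le_total 0 (f x) with hx | hx
  · have h1 : truncate f hf n x ≤ f x := by
      have := abs_truncate_le f hf n x
      rw [abs_of_nonneg hx] at this
      exact (le_abs_self _).trans this
    have h2 : Real.exp (t * truncate f hf n x) ≤ Real.exp (t * f x) := by gcongr
    linarith
  · have h1 : truncate f hf n x ≤ 0 := by
      rw [truncate_apply]
      exact max_le (by linarith) ((min_le_right _ _).trans hx)
    have h2 : Real.exp (t * truncate f hf n x) ≤ 1 :=
      Real.exp_le_one_iff.2 (mul_nonpos_of_nonneg_of_nonpos ht h1)
    linarith [Real.exp_pos (t * f x)]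

lemma tendsto_integral_truncate {μ : Measure (EuclideanSpace ℝ (Fin d))} [IsProbabilityMeasure μ]
    {f : EuclideanSpace ℝ (Fin d) → ℝ} (hf : Continuous f) {t : ℝ} (ht : 0 ≤ t)
    (hfi : Integrable f μ) (htf : Integrable (fun x => Real.exp (t * f x)) μ)
    (hftf : Integrable (fun x => f x * Real.exp (t * f x)) μ) :
    Filter.Tendsto (fun n => expCov μ (truncate f hf n) t) Filter.atTop
        (nhds (expCov μ f t)) ∧
      Filter.Tendsto (fun n => ∫ x, Real.exp (t * truncate f hf n x) ∂μ) Filter.atTop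
        (nhds (∫ x, Real.exp (t * f x) ∂μ)) := by
  have h1 : Filter.Tendsto (fun n => ∫ x, truncate f hf n x ∂μ) Filter.atTop
      (nhds (∫ x, f x ∂μ)) := by
    refine tendsto_integral_of_dominated_convergence (fun x => |f x|)
      (fun n => (truncate f hf n).continuous.aestronglyMeasurable) hfi.abs
      (fun n => Filter.Eventually.of_forall fun x => abs_truncate_le f hf n x)
      (Filter.Eventually.of_forall fun x => tendsto_truncate f hf x)
  have h2 : Filter.Tendsto (fun n => ∫ x, Real.exp (t * truncate f hf n x) ∂μ) Filter.atTop
      (nhds (∫ x, Real.exp (t * f x) ∂μ)) := by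
    refine tendsto_integral_of_dominated_convergence (fun x => Real.exp (t * f x) + 1)
      (fun n => Continuous.aestronglyMeasurable (by fun_prop)) (htf.add (integrable_const _))
      (fun n => Filter.Eventually.of_forall fun x => ?_)
      (Filter.Eventually.of_forall fun x => ?_)
    · rw [Real.norm_eq_abs, Real.abs_exp]
      exact exp_mul_truncate_le f hf ht n x
    · exact (Real.continuous_exp.tendsto _).comp ((tendsto_truncate f hf x).const_mul t)
  have h3 : Filter.Tendsto (fun n => ∫ x, truncate f hf n x * Real.exp (t * truncate f hf n x) ∂μ)
      Filter.atTop (nhds (∫ x, f x * Real.exp (t * f x) ∂μ)) := by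
    refine tendsto_integral_of_dominated_convergence
      (fun x => |f x * Real.exp (t * f x)| + |f x|)
      (fun n => Continuous.aestronglyMeasurable (by fun_prop)) (hftf.abs.add hfi.abs)
      (fun n => Filter.Eventually.of_forall fun x => ?_)
      (Filter.Eventually.of_forall fun x => ?_)
    · rw [norm_mul, Real.norm_eq_abs, Real.norm_eq_abs, Real.abs_exp, abs_mul, Real.abs_exp]
      calc |truncate f hf n x| * Real.exp (t * truncate f hf n x)
          ≤ |f x| * (Real.exp (t * f x) + 1) := by
            refine mul_le_mul (abs_truncate_le f hf n x) (exp_mul_truncate_le f hf ht n x)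
              (Real.exp_pos _).le (abs_nonneg _)
        _ = |f x| * Real.exp (t * f x) + |f x| := by ring
    · exact (tendsto_truncate f hf x).mul
        ((Real.continuous_exp.tendsto _).comp ((tendsto_truncate f hf x).const_mul t))
  exact ⟨h3.sub (h1.mul h2), h2⟩

end Truncation

/-! ### Integrability of the function. -/

section Vector

variable {d : ℕ}

/-- Growth is at most linear, and s‖x‖ ≤ e^{s‖x‖} lets the exponential moment dominate it. -/
lemma integrable_of_increments {μ : Measure (EuclideanSpace ℝ (Fin d))} [IsProbabilityMeasure μ]
    {f : EuclideanSpace ℝ (Fin d) → ℝ} {b s : ℝ} (hb : 0 ≤ b) (hs : 0 < s)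
    (hexp : Integrable (fun x => Real.exp (s * ‖x‖)) μ)
    (hf : ∀ (k : Fin d) (u : ℝ) (x : EuclideanSpace ℝ (Fin d)),
      |f (x + EuclideanSpace.single k u) - f x| ≤ b * |u|) : Integrable f μ := by
  refine ((integrable_const |f 0|).add (hexp.const_mul (d * b / s))).mono'
    (continuous_of_increments hf).aestronglyMeasurable (Filter.Eventually.of_forall fun x => ?_)
  have h1 := abs_sub_le_of_increments hf 0 x
  rw [zero_add] at h1
  have h2 : ∑ k, b * |x k| ≤ d * (b * ‖x‖) := by
    refine (Finset.sum_le_card_nsmul Finset.univ _ (b * ‖x‖) fun k _ => ?_).trans_eq (by simp)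
    exact mul_le_mul_of_nonneg_left (PiLp.norm_apply_le x k) hb
  have h3 : s * ‖x‖ ≤ Real.exp (s * ‖x‖) := by linarith [Real.add_one_le_exp (s * ‖x‖)]
  have h4 : d * (b * ‖x‖) = d * b / s * (s * ‖x‖) := by field_simp
  have h5 : d * b / s * (s * ‖x‖) ≤ d * b / s * Real.exp (s * ‖x‖) := by gcongr
  have h6 := abs_sub_abs_le_abs_sub (f x) (f 0)
  simp only [Pi.add_apply, Real.norm_eq_abs]
  linarith

end Vector

/-! ### The inequality for the given function. -/

theorem corollary6 {Ω : Type*} [MeasurableSpace Ω] (P : Measure Ω) [IsProbabilityMeasure P]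
    (d : ℕ) (X : Ω → EuclideanSpace ℝ (Fin d))
    (γ : EuclideanSpace ℝ (Fin d)) (ν : Measure (EuclideanSpace ℝ (Fin d))) (ν' : Measure ℝ)
    (hX : HasIDLaw X γ ν P)
    (hiid : HasIIDComponents X P)
    (hν : ν = axisMeasure (fun _ : Fin d => ν'))
    (hexp : ∃ s : ℝ, 0 < s ∧ Integrable (fun ω => Real.exp (s * ‖X ω‖)) P)
    (f : EuclideanSpace ℝ (Fin d) → ℝ)
    (hf0 : ∫ ω, f (X ω) ∂P = 0)
    (b : ℝ) (hb : b ≠ 0)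
    (hf : ∀ (k : Fin d) (u : ℝ) (x : EuclideanSpace ℝ (Fin d)),
      |f (x + EuclideanSpace.single k u) - f x| ≤ b * |u|)
    (C : ℝ → EuclideanSpace ℝ (Fin d) → ℝ)
    (hC : ∀ u : ℝ, ∀ᵐ ω ∂P,
      ∑ k : Fin d, |f (X ω + EuclideanSpace.single k u) - f (X ω)| ^ 2 ≤ u ^ 2 * C u (X ω))
    (lam : ℝ → ℝ → ℝ) (t : ℝ) (ht : 0 ≤ t)
    (hlam : ∀ u : ℝ, 0 < lam u t)
    (hφ : ∀ u : ℝ, Integrable (fun ω => Real.exp (lam u t * C u (X ω))) P)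
    (htf : Integrable (fun ω => Real.exp (t * f (X ω))) P)
    (hftf : Integrable (fun ω => f (X ω) * Real.exp (t * f (X ω))) P)
    (hh : Integrable (fun u => hIntegrand lam b t u) ν')
    (hg : Integrable (fun u => gIntegrand P X C lam b t u) ν') :
    (1 - hFun ν' lam b t) * ∫ ω, f (X ω) * Real.exp (t * f (X ω)) ∂P ≤
      gFun P X ν' C lam b t * ∫ ω, Real.exp (t * f (X ω)) ∂P := by
  have hfc : Continuous f := continuous_of_increments hf
  -- `squaredIncrements f u` is the least admissible `C u` for u ≠ 0, and it is continuous. The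
  -- freedom in `D` covers truncations of `f` and, for d = 0, the zero function.
  have hφ1 : ∀ u, u ≠ 0 → ∀ D : EuclideanSpace ℝ (Fin d) → ℝ, Continuous D →
      (∀ x, D x ≤ squaredIncrements f u x) → (∀ x, 0 ≤ D x) →
      ∫ ω, Real.exp (lam u t * D (X ω)) ∂P ≤ phiMoment P X C lam u t := by
    intro u hu D hD hDle hD0
    refine integral_mono_of_nonneg (Filter.Eventually.of_forall fun ω => (Real.exp_pos _).le)
      (hφ u) ?_
    filter_upwards [hC u] with ω hω
    have h1 : squaredIncrements f u (X ω) ≤ C u (X ω) := by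
      rw [squaredIncrements, div_le_iff₀ (by positivity), mul_comm]
      simpa only [sq_abs] using hω
    have := hlam u
    gcongr
    exact (hDle _).trans h1
  -- For d = 0 the increment condition is empty and b may be negative. Then f(X) = 0, and the claim
  -- is g(t) ≥ 0, which holds because φ ≥ 1 for u ≠ 0 and (e^{tb|u|} - 1)/b ≥ 0 for either sign of
  -- b.
  rcases Nat.eq_zero_or_pos d with rfl | hd
  · have hconst : ∀ ω, f (X ω) = 0 := by
      intro ω
      have h1 : ∀ ω', f (X ω') = f (X ω) := fun ω' => by rw [Subsingleton.elim (X ω') (X ω)]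
      simp only [h1] at hf0
      simpa using hf0
    simp only [hconst, integral_zero, mul_zero, Real.exp_zero, integral_const,
      probReal_univ, smul_eq_mul, mul_one]
    refine integral_nonneg fun u => ?_
    simp only [gIntegrand, Pi.zero_apply]
    rcases eq_or_ne u 0 with rfl | hu
    · simp
    have h1 := hφ1 u hu 0 continuous_const (fun x => squaredIncrements_nonneg f u x)
      fun _ => le_rfl
    simp only [Pi.zero_apply, mul_zero, Real.exp_zero, integral_const, probReal_univ, smul_eq_mul,
      mul_one] at h1
    have h2 : 0 ≤ (Real.exp (t * b * |u|) - 1) / b := by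
      rcases lt_or_gt_of_ne hb with hb' | hb'
      · refine div_nonneg_of_nonpos ?_ hb'.le
        rw [sub_nonpos, Real.exp_le_one_iff]
        exact mul_nonpos_of_nonpos_of_nonneg (mul_nonpos_of_nonneg_of_nonpos ht hb'.le)
          (abs_nonneg u)
      · refine div_nonneg ?_ hb'.le
        rw [sub_nonneg, Real.one_le_exp_iff]
        positivity
    exact mul_nonneg (mul_nonneg (div_nonneg (Real.log_nonneg h1) (hlam u).le) (abs_nonneg u)) h2
  have hb0 : 0 < b := by
    have h1 := (abs_nonneg _).trans (hf ⟨0, hd⟩ 1 0)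
    rw [abs_one, mul_one] at h1
    exact lt_of_le_of_ne h1 hb.symm
  subst hν
  let μ := P.map X
  have hμp : IsProbabilityMeasure μ := Measure.isProbabilityMeasure_map hX.aemeasurable
  have hpush : ∀ q : EuclideanSpace ℝ (Fin d) → ℝ, Continuous q →
      ∫ x, q x ∂μ = ∫ ω, q (X ω) ∂P := fun q hq =>
    integral_map hX.aemeasurable hq.aestronglyMeasurable
  have hpushi : ∀ q : EuclideanSpace ℝ (Fin d) → ℝ, Continuous q →
      Integrable (fun ω => q (X ω)) P → Integrable q μ := fun q hq h =>
    (integrable_map_measure hq.aestronglyMeasurable hX.aemeasurable).2 h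
  obtain ⟨s, hs, hsi⟩ := hexp
  -- This makes `hf0` a genuine zero mean and not the default value of the integral.
  have hfi : Integrable f μ := integrable_of_increments hb0.le hs
    (hpushi (fun x => Real.exp (s * ‖x‖)) (by fun_prop) hsi) hf
  obtain ⟨hl1, hl2⟩ := tendsto_integral_truncate (μ := μ) hfc ht hfi
    (hpushi _ (by fun_prop) htf) (hpushi (fun x => f x * Real.exp (t * f x)) (by fun_prop) hftf)
  have hcov : expCov μ f t = ∫ ω, f (X ω) * Real.exp (t * f (X ω)) ∂P := by
    rw [expCov, hpush f hfc, hf0, zero_mul, sub_zero,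
      hpush (fun x => f x * Real.exp (t * f x)) (by fun_prop)]
  -- Truncations need not be centred, so the bound is kept in covariance form until the limit. It is
  -- never divided by 1 - h(t), whose sign is unknown.
  have hbd : ∀ n, expCov μ (truncate f hfc n) t ≤
      hFun ν' lam b t * expCov μ (truncate f hfc n) t +
        gFun P X ν' C lam b t * ∫ x, Real.exp (t * truncate f hfc n x) ∂μ := by
    intro n
    refine expCov_le_of_bounded hX.isLevyMeasure hX.charFun_eq (truncate f hfc n) hb0 ht
      (l := fun u => lam u t) (φ := fun u => phiMoment P X C lam u t) hlam
      (fun k u x => (abs_truncate_sub_le f hfc n _ _).trans (hf k u x)) (fun u hu => ?_) hh hg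
    have hc := continuous_squaredIncrements (truncate f hfc n).continuous u
    rw [hpush (fun x => Real.exp (lam u t * squaredIncrements (truncate f hfc n) u x))
      (by fun_prop)]
    refine hφ1 u hu _ hc (fun x => ?_) fun x => squaredIncrements_nonneg _ u x
    rw [squaredIncrements, squaredIncrements]
    gcongr ?_ / _
    refine Finset.sum_le_sum fun k _ => ?_
    exact sq_le_sq.2 (abs_truncate_sub_le f hfc n _ _)
  have hfinal := le_of_tendsto_of_tendsto' hl1
    ((hl1.const_mul (hFun ν' lam b t)).add (hl2.const_mul (gFun P X ν' C lam b t))) hbd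
  rw [hcov, hpush (fun x => Real.exp (t * f x)) (by fun_prop)] at hfinal
  linarith
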